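/- Let $m\ge 2$ and $n\ge 1$ be integers. For a linear map $A:\mathbb R^m\to\mathbb R^n$ and a bilinear map $B:\mathbb R^m\times\mathbb R^m\to\mathbb R^n$ write $$|||A|||=\sup_{|v|=1}|A(v)|,\qquad |||B|||=\sup_{|v|=1}|B(v,v)|,$$ where $|\cdot|$ is the Euclidean norm. Let $\Omega\subset\mathbb R^m$ be a (nonempty) bounded, convex domain with $C^2$ boundary, let $\phi:\overline\Omega\to\mathbb R^n$ be $C^2$ on $\overline\Omega$, and suppose that for some $\kappa\in(0,1)$ $$\frac{4m\,\operatorname{diam}\Omega}{\kappa}\,\sup_{\Omega}|||D^2\phi|||+2\sup_{\partial\Omega}|||D\phi|||<\sqrt{1-\kappa^{1/m}}.$$ Let $u:\overline\Omega\to\mathbb R^n$ be a smooth solution ($C^\infty$ in $\Omega$ and $C^1$ on $\overline\Omega$) of the maximal graph Dirichlet problem $$\sum_{i,j=1}^m g^{ij}(Du)\,\frac{\partial^2u}{\partial x^i\partial x^j}=0\ \text{ and }\ |||Du|||<1\ \text{ in }\Omega,\qquad u=\phi\ \text{ on }\partial\Omega,$$ where $(g^{ij}(Du))$ is the inverse of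 the matrix $g=I-(Du)^{T}Du$. If $\sup_\Omega|||Du|||^2\le 1-\kappa$, then $$\sup_\Omega|||Du|||^2<1-\kappa .$$ -/

import Mathlib

open Set Metric
open scoped ContDiff

namespace MaximalGraph

/-- `ℝᵏ` with its Euclidean norm. -/
abbrev E (k : ℕ) : Type := EuclideanSpace ℝ (Fin k)

/-- `|||A||| = sup_{|v| = 1} |A v|` for a linear map `A : ℝᵐ → ℝⁿ`. -/
noncomputable def supNorm {m n : ℕ} (A : E m →L[ℝ] E n) : ℝ :=
  sSup ((fun v : E m => ‖A v‖) '' sphere (0 : E m) 1)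

/-- `|||B||| = sup_{|v| = 1} |B(v, v)|` for a bilinear map `B : ℝᵐ × ℝᵐ → ℝⁿ`. -/
noncomputable def supNorm₂ {m n : ℕ}
    (B : ContinuousMultilinearMap ℝ (fun _ : Fin 2 => E m) (E n)) : ℝ :=
  sSup ((fun v : E m => ‖B ![v, v]‖) '' sphere (0 : E m) 1)

/-- The standard basis vectors of `ℝᵐ`. -/
noncomputable def stdVec {m : ℕ} (i : Fin m) : E m := EuclideanSpace.single i (1 : ℝ)

/-- The Jacobian matrix `(∂u^γ / ∂x^i)` of `u : ℝᵐ → ℝⁿ` at `x`. -/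
noncomputable def jacobian {m n : ℕ} (u : E m → E n) (x : E m) : Matrix (Fin n) (Fin m) ℝ :=
  Matrix.of fun γ i => fderiv ℝ u x (stdVec i) γ

open scoped Matrix in
/-- The metric `g = I - Duᵀ Du` that the semi-Euclidean space `ℝᵐ⁺ⁿₙ` induces on the graph
of `u`. -/
noncomputable def inducedMetric {m n : ℕ} (u : E m → E n) (x : E m) :
    Matrix (Fin m) (Fin m) ℝ :=
  1 - (jacobian u x)ᵀ * jacobian u x

/-- The vector `g^{ij}(Du) ∂²u / ∂x^i ∂x^j` at `x`, where `(g^{ij})` is the inverse of `g`. -/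
noncomputable def maximalOperator {m n : ℕ} (u : E m → E n) (x : E m) : E n :=
  ∑ i : Fin m, ∑ j : Fin m,
    ((inducedMetric u x)⁻¹ i j) • iteratedFDeriv ℝ 2 u x ![stdVec i, stdVec j]

/-- `Ω` has `C²` boundary: near each boundary point, `Ω` is the sublevel set `{ρ < 0}` of a `C²`
function `ρ` without critical points. -/
def HasC2Boundary {m : ℕ} (Ω : Set (E m)) : Prop :=
  ∀ p ∈ frontier Ω, ∃ (U : Set (E m)) (ρ : E m → ℝ),
    IsOpen U ∧ p ∈ U ∧ ContDiffOn ℝ 2 ρ U ∧ (∀ x ∈ U, fderiv ℝ ρ x ≠ 0) ∧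
      Ω ∩ U = {x ∈ U | ρ x < 0}

/-- `u` is a smooth solution of the maximal graph Dirichlet problem in `Ω` with boundary values
`φ`: it is smooth in `Ω` and `C¹` up to the boundary, its graph is spacelike with zero mean
curvature, and `u = φ` on `∂Ω`. -/
structure IsSmoothSolution {m n : ℕ} (Ω : Set (E m)) (φ u : E m → E n) : Prop where
  smooth : ContDiffOn ℝ ∞ u Ω
  contDiffOn_closure : ContDiffOn ℝ 1 u (closure Ω)
  maximal : ∀ x ∈ Ω, maximalOperator u x = 0
  spacelike : ∀ x ∈ Ω, supNorm (fderiv ℝ u x) < 1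
  boundary : ∀ x ∈ frontier Ω, u x = φ x

end MaximalGraph

namespace MaximalGraph
open scoped Matrix Topology

/-! ### Linear algebra of positive semidefinite matrices and of `1 - JᵀJ`. -/

section LinearAlgebra

variable {m n : ℕ}

/-! The quantity to control is `det g`. The eigenvalues of `g = 1 - DuᵀDu` lie in `(0, 1]`, so `det
g` is at most the smallest of them, which gives `|||Du|||² ≤ 1 - det g`. Conversely `|||Du||| ≤ c ≤
1` gives `det g ≥ (1 - c²)^m`. It therefore suffices to bound `Du` on the boundary and to carry a
lower bound for `det g` inside.

Interior: `log det g` is a supersolution of `g^{kl} ∂_k ∂_l` (`contracted_hessian_log_det_nonpos`).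
Differentiating the equation expresses the contracted third derivatives of `u` through second
derivatives, and what remains has a sign by the matrix inequality `trace_sq_le`. Hence `det g` is
bounded below by its boundary minimum (`le_det_of_le_on_frontier`).

Boundary: the assumed bound gives `g ≥ κ`, so `tr g⁻¹ ≤ m/κ`, while `g⁻¹ ≥ 1` always. A concave
quadratic in the distance to a supporting hyperplane is then a barrier for each component of `u - φ`
(`barrier_comparison`). It yields `|||Du||| ≤ c` on the boundary, with `c` as close as desired to
`(m/κ) diam Ω sup|||D²φ||| + sup|||Dφ|||`. Smallness of the data allows `c² < 1 - κ^{1/m}`, that is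
`(1 - c²)^m > κ`, and this strict gap is uniform over `Ω`. -/

lemma exists_transpose_mul_self {P : Matrix (Fin m) (Fin m) ℝ} (hP : P.PosSemidef) :
    ∃ B : Matrix (Fin m) (Fin m) ℝ, P = Bᵀ * B := by
  classical
  open scoped MatrixOrder in
  obtain ⟨B, hB⟩ := CStarAlgebra.nonneg_iff_eq_star_mul_self.mp hP.nonneg
  exact ⟨B, by simpa [Matrix.star_eq_conjTranspose] using hB⟩

lemma trace_mul_transpose_nonneg (A : Matrix (Fin n) (Fin m) ℝ) : 0 ≤ (A * Aᵀ).trace := by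
  simpa using (Matrix.posSemidef_self_mul_conjTranspose A).trace_nonneg

/-- `tr (P N P N) ≤ tr (P N P Nᵀ)` for positive semidefinite `P`. -/
lemma trace_sq_le {P N : Matrix (Fin m) (Fin m) ℝ} (hP : P.PosSemidef) :
    (P * N * P * N).trace ≤ (P * N * P * Nᵀ).trace := by
  obtain ⟨B, rfl⟩ := exists_transpose_mul_self hP
  -- With `P = BᵀB`, this squared Hilbert–Schmidt norm expands to twice the difference of the two
  -- sides.
  have h := trace_mul_transpose_nonneg (B * (N - Nᵀ) * Bᵀ)
  have e1 : (B * (N - Nᵀ) * Bᵀ * (B * (N - Nᵀ) * Bᵀ)ᵀ).trace =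
      (Bᵀ * B * (N - Nᵀ) * (Bᵀ * B) * (Nᵀ - N)).trace := by
    simp only [Matrix.transpose_mul, Matrix.transpose_sub, Matrix.transpose_transpose]
    have : B * (N - Nᵀ) * Bᵀ * (B * ((Nᵀ - N) * Bᵀ)) =
      (B * (N - Nᵀ) * Bᵀ * B * (Nᵀ - N)) * Bᵀ := by simp only [Matrix.mul_assoc]
    rw [this, Matrix.trace_mul_comm]
    simp only [Matrix.mul_assoc]
  rw [e1] at h
  have e2 : (Bᵀ * B * Nᵀ * (Bᵀ * B) * N).trace = (Bᵀ * B * N * (Bᵀ * B) * Nᵀ).trace := by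
    rw [show Bᵀ * B * Nᵀ * (Bᵀ * B) * N = (Bᵀ * B * Nᵀ) * ((Bᵀ * B) * N) by
      simp only [Matrix.mul_assoc], Matrix.trace_mul_comm]
    simp only [Matrix.mul_assoc]
  have e3 : (Bᵀ * B * Nᵀ * (Bᵀ * B) * Nᵀ).trace = (Bᵀ * B * N * (Bᵀ * B) * N).trace := by
    rw [← Matrix.trace_transpose]
    simp only [Matrix.transpose_mul, Matrix.transpose_transpose]
    rw [show N * (Bᵀ * B * (N * (Bᵀ * B))) = (N * (Bᵀ * B * N)) * (Bᵀ * B) by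
      simp only [Matrix.mul_assoc], Matrix.trace_mul_comm]
    simp only [Matrix.mul_assoc]
  simp only [Matrix.mul_sub, Matrix.sub_mul, Matrix.trace_sub] at h
  linarith

lemma eigenvalue_ge {g : Matrix (Fin m) (Fin m) ℝ} (hg : g.IsHermitian) {c : ℝ}
    (h : ∀ v : Fin m → ℝ, c * (v ⬝ᵥ v) ≤ v ⬝ᵥ g *ᵥ v) (i : Fin m) : c ≤ hg.eigenvalues i := by
  have h1 := h (hg.eigenvectorBasis i)
  rw [hg.mulVec_eigenvectorBasis i] at h1
  have h2 : (hg.eigenvectorBasis i : Fin m → ℝ) ⬝ᵥ (hg.eigenvectorBasis i) = 1 := by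
    have := hg.eigenvectorBasis.orthonormal.1 i
    have h3 := EuclideanSpace.real_norm_sq_eq (hg.eigenvectorBasis i)
    rw [this] at h3
    simp only [dotProduct, ← pow_two]
    linarith
  rw [dotProduct_smul, h2] at h1
  simpa using h1

lemma eigenvalue_le {g : Matrix (Fin m) (Fin m) ℝ} (hg : g.IsHermitian) {c : ℝ}
    (h : ∀ v : Fin m → ℝ, v ⬝ᵥ g *ᵥ v ≤ c * (v ⬝ᵥ v)) (i : Fin m) : hg.eigenvalues i ≤ c := by
  have h1 := h (hg.eigenvectorBasis i)
  rw [hg.mulVec_eigenvectorBasis i] at h1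
  have h2 : (hg.eigenvectorBasis i : Fin m → ℝ) ⬝ᵥ (hg.eigenvectorBasis i) = 1 := by
    have := hg.eigenvectorBasis.orthonormal.1 i
    have h3 := EuclideanSpace.real_norm_sq_eq (hg.eigenvectorBasis i)
    rw [this] at h3
    simp only [dotProduct, ← pow_two]
    linarith
  rw [dotProduct_smul, h2] at h1
  simpa using h1

lemma pow_le_det {g : Matrix (Fin m) (Fin m) ℝ} (hg : g.IsHermitian) {c : ℝ} (hc : 0 ≤ c)
    (h : ∀ v : Fin m → ℝ, c * (v ⬝ᵥ v) ≤ v ⬝ᵥ g *ᵥ v) : c ^ m ≤ g.det := by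
  rw [hg.det_eq_prod_eigenvalues]
  calc c ^ m = ∏ _i : Fin m, c := by simp
    _ ≤ _ := Finset.prod_le_prod (fun _ _ => hc) fun i _ => by simpa using eigenvalue_ge hg h i

/-- If `0 ≤ g ≤ 1` then `det g ≤ g`. -/
lemma det_le_quadratic {g : Matrix (Fin m) (Fin m) ℝ} (hg : g.PosSemidef)
    (h : ∀ v : Fin m → ℝ, v ⬝ᵥ g *ᵥ v ≤ v ⬝ᵥ v) (v : Fin m → ℝ) :
    g.det * (v ⬝ᵥ v) ≤ v ⬝ᵥ g *ᵥ v := by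
  -- All eigenvalues lie in `[0, 1]`, so their product is at most each factor.
  have hle : ∀ i, g.det ≤ hg.1.eigenvalues i := fun i => by
    rw [hg.1.det_eq_prod_eigenvalues]
    rw [← Finset.mul_prod_erase _ _ (Finset.mem_univ i)]
    have h0 := hg.eigenvalues_nonneg i
    refine (mul_le_mul_of_nonneg_left (Finset.prod_le_one (fun j _ => ?_) fun j _ => ?_)
      (by simpa using h0)).trans (by simp)
    · simpa using hg.eigenvalues_nonneg j
    · simpa using eigenvalue_le hg.1 (c := 1) (by simpa using h) j
  have hgd : (g - g.det • (1 : Matrix (Fin m) (Fin m) ℝ)).PosSemidef := by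
    have hs := hg.1.spectral_theorem
    have hd : (Matrix.diagonal (fun i => hg.1.eigenvalues i - g.det)).PosSemidef :=
      Matrix.PosSemidef.diagonal fun i => by simpa using hle i
    have h3 := hd.mul_mul_conjTranspose_same (hg.1.eigenvectorUnitary : Matrix (Fin m) (Fin m) ℝ)
    convert h3 using 1
    have hu : (hg.1.eigenvectorUnitary : Matrix (Fin m) (Fin m) ℝ) *
      (hg.1.eigenvectorUnitary : Matrix (Fin m) (Fin m) ℝ)ᴴ = 1 :=
      Unitary.mul_star_self_of_mem hg.1.eigenvectorUnitary.2
    have : Matrix.diagonal (fun i => hg.1.eigenvalues i - g.det) =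
      Matrix.diagonal hg.1.eigenvalues - g.det • (1 : Matrix (Fin m) (Fin m) ℝ) := by
      rw [Matrix.smul_one_eq_diagonal, Matrix.diagonal_sub]
    rw [this, Matrix.mul_sub, Matrix.sub_mul, Matrix.mul_smul, Matrix.smul_mul, Matrix.mul_one, hu]
    congr 1
  have := hgd.dotProduct_mulVec_nonneg v
  simp only [star_trivial, Matrix.sub_mulVec, dotProduct_sub, Matrix.smul_mulVec,
    Matrix.one_mulVec, dotProduct_smul, smul_eq_mul] at this
  linarith

/-- The quadratic form of `1 - JᵀJ`. -/
lemma quadratic_one_sub (J : Matrix (Fin n) (Fin m) ℝ) (v : Fin m → ℝ) :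
    v ⬝ᵥ (1 - Jᵀ * J) *ᵥ v = v ⬝ᵥ v - (J *ᵥ v) ⬝ᵥ (J *ᵥ v) := by
  rw [Matrix.sub_mulVec, dotProduct_sub, Matrix.one_mulVec, ← Matrix.mulVec_mulVec,
    Matrix.dotProduct_mulVec, Matrix.vecMul_transpose]

lemma isHermitian_one_sub (J : Matrix (Fin n) (Fin m) ℝ) : (1 - Jᵀ * J).IsHermitian := by
  simp [Matrix.IsHermitian, Matrix.conjTranspose_eq_transpose_of_trivial]

lemma dotProduct_self_nonneg' {k : ℕ} (v : Fin k → ℝ) : 0 ≤ v ⬝ᵥ v :=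
  Finset.sum_nonneg fun i _ => mul_self_nonneg (v i)

variable {J : Matrix (Fin n) (Fin m) ℝ} {κ : ℝ}

lemma posDef_one_sub (hκ : 0 < κ)
    (h : ∀ v : Fin m → ℝ, κ * (v ⬝ᵥ v) ≤ v ⬝ᵥ (1 - Jᵀ * J) *ᵥ v) : (1 - Jᵀ * J).PosDef := by
  refine .of_dotProduct_mulVec_pos (isHermitian_one_sub J) fun v hv => ?_
  have : 0 < v ⬝ᵥ v := lt_of_le_of_ne (dotProduct_self_nonneg' v)
    (Ne.symm (by simpa [dotProduct_self_eq_zero] using hv))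
  simpa using (mul_pos hκ this).trans_le (h v)

/-- Iterating `P = 1 + JᵀJ P` gives `P = 1 + JᵀJ + JᵀJ P JᵀJ`, whose last two terms are positive
semidefinite. This is the lower ellipticity bound, independent of `κ`, that the barrier needs. -/
lemma inv_sub_one_posSemidef (hg : (1 - Jᵀ * J).PosDef) (v : Fin m → ℝ) :
    v ⬝ᵥ v ≤ v ⬝ᵥ (1 - Jᵀ * J)⁻¹ *ᵥ v := by
  set P := (1 - Jᵀ * J)⁻¹ with hP
  have hdet : IsUnit (1 - Jᵀ * J).det := (Matrix.isUnit_iff_isUnit_det _).1 hg.isUnit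
  have h1 : P * (1 - Jᵀ * J) = 1 := Matrix.nonsing_inv_mul _ hdet
  have h2 : (1 - Jᵀ * J) * P = 1 := Matrix.mul_nonsing_inv _ hdet
  have h3 : P = 1 + Jᵀ * J + (Jᵀ * J) * P * (Jᵀ * J) := by
    have a : P = 1 + P * (Jᵀ * J) := by
      rw [← h1]; simp [Matrix.mul_sub]
    have b : P = 1 + (Jᵀ * J) * P := by
      rw [← h2]; simp [Matrix.sub_mul]
    calc P = 1 + (Jᵀ * J) * P := b
      _ = 1 + (Jᵀ * J) * (1 + P * (Jᵀ * J)) := by rw [← a]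
      _ = _ := by simp only [Matrix.mul_add, Matrix.mul_one, Matrix.mul_assoc, add_assoc]
  have hps : (Jᵀ * J + (Jᵀ * J) * P * (Jᵀ * J)).PosSemidef := by
    refine .add (by simpa using Matrix.posSemidef_conjTranspose_mul_self J) ?_
    have := hg.inv.posSemidef.mul_mul_conjTranspose_same (Jᵀ * J)
    simpa [Matrix.conjTranspose_eq_transpose_of_trivial, ← hP] using this
  have := hps.dotProduct_mulVec_nonneg v
  rw [h3, add_assoc, Matrix.add_mulVec, dotProduct_add, Matrix.one_mulVec]
  simpa using this

/-- Testing the bound on the column `g⁻¹ eᵢ` gives `κ (gⁱⁱ)² ≤ κ |g⁻¹ eᵢ|² ≤ gⁱⁱ`, so each diagonal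
entry is at most `1/κ`. This is the source of `m/κ`. -/
lemma inv_trace_le (hκ : 0 < κ)
    (h : ∀ v : Fin m → ℝ, κ * (v ⬝ᵥ v) ≤ v ⬝ᵥ (1 - Jᵀ * J) *ᵥ v) :
    ((1 - Jᵀ * J)⁻¹).trace ≤ m / κ := by
  have hg := posDef_one_sub hκ h
  set g := 1 - Jᵀ * J with hgdef
  have hdet : IsUnit g.det := (Matrix.isUnit_iff_isUnit_det _).1 hg.isUnit
  have h2 : g * g⁻¹ = 1 := Matrix.mul_nonsing_inv _ hdet
  have hsym : (g⁻¹)ᵀ = g⁻¹ := by simpa [Matrix.IsHermitian] using hg.inv.1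
  have hi : ∀ i, g⁻¹ i i ≤ 1 / κ := fun i => by
    have h3 := h (g⁻¹ *ᵥ Pi.single i 1)
    rw [Matrix.mulVec_mulVec, h2, Matrix.one_mulVec] at h3
    have h4 : (g⁻¹ *ᵥ Pi.single i 1) ⬝ᵥ Pi.single i 1 = g⁻¹ i i := by simp
    have h5 : (g⁻¹ i i) ^ 2 ≤ (g⁻¹ *ᵥ Pi.single i 1) ⬝ᵥ (g⁻¹ *ᵥ Pi.single i 1) := by
      simp only [dotProduct]
      refine le_trans (le_of_eq ?_) (Finset.single_le_sum
        (f := fun j => (g⁻¹ *ᵥ Pi.single i 1) j * (g⁻¹ *ᵥ Pi.single i 1) j)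
        (fun j _ => mul_self_nonneg _) (Finset.mem_univ i))
      simp [pow_two]
    rw [h4] at h3
    have h6 : κ * (g⁻¹ i i) ^ 2 ≤ g⁻¹ i i := (mul_le_mul_of_nonneg_left h5 hκ.le).trans h3
    by_contra! hc
    have : 1 < g⁻¹ i i * κ := by rwa [div_lt_iff₀ hκ] at hc
    have : 0 < g⁻¹ i i := lt_trans (by positivity) hc
    nlinarith
  calc (g⁻¹).trace = ∑ i, g⁻¹ i i := rfl
    _ ≤ ∑ _i : Fin m, 1 / κ := Finset.sum_le_sum fun i _ => hi i
    _ = m / κ := by simp [div_eq_mul_inv]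

end LinearAlgebra

/-! ### The algebraic inequality between second and third derivatives. -/

section PointwiseInequality

variable {m n : ℕ}

/-- Passing to the frame given by the rows of `B` turns contraction with `P` into a plain sum over
`s`, so that signs can be read off term by term. -/
lemma sum_smul_mul_mul {a b c d : ℕ} {P B : Matrix (Fin m) (Fin m) ℝ} (hB : P = Bᵀ * B)
    (X : Fin m → Matrix (Fin a) (Fin b) ℝ) (R : Matrix (Fin b) (Fin c) ℝ)
    (Y : Fin m → Matrix (Fin c) (Fin d) ℝ) :
    ∑ l, ∑ k, P l k • (X l * R * Y k) =
      ∑ s, (∑ l, B s l • X l) * R * (∑ k, B s k • Y k) := by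
  simp only [Matrix.sum_mul, Matrix.mul_sum, Matrix.smul_mul, Matrix.mul_smul, Finset.smul_sum,
    smul_smul, hB, Matrix.mul_apply, Matrix.transpose_apply, Finset.sum_smul]
  calc _ = ∑ y, ∑ s, ∑ x, (B s y * B s x) • (X y * R * Y x) :=
        Finset.sum_congr rfl fun _ _ => Finset.sum_comm
    _ = ∑ s, ∑ y, ∑ x, (B s y * B s x) • (X y * R * Y x) := Finset.sum_comm
    _ = _ := Finset.sum_congr rfl fun s _ => by
        rw [Finset.sum_comm]
        exact Finset.sum_congr rfl fun x _ => Finset.sum_congr rfl fun y _ => by rw [mul_comm]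

/-- Contracting the differentiated equation: the trace of the third derivatives. -/
lemma contracted_third_derivative {P B : Matrix (Fin m) (Fin m) ℝ} (hB : P = Bᵀ * B)
    (J : Matrix (Fin n) (Fin m) ℝ) (H : Fin m → Matrix (Fin n) (Fin m) ℝ)
    (hH : ∀ k γ l, H k γ l = H l γ k) (i : Fin m) (γ : Fin n) :
    ∑ k, ∑ l, (P * ((H i)ᵀ * J + Jᵀ * H i) * P) k l * H k γ l =
      2 * (∑ s, (∑ l, B s l • H l) * (P * Jᵀ) * (∑ l, B s l • H l)) γ i := by
  have hPs : Pᵀ = P := by rw [hB]; simp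
  have hsym : ∀ k l, (P * ((H i)ᵀ * J) * P) k l = (P * (Jᵀ * H i) * P) l k := fun k l => by
    rw [← Matrix.transpose_apply (P * (Jᵀ * H i) * P), Matrix.transpose_mul, Matrix.transpose_mul,
      Matrix.transpose_mul, Matrix.transpose_transpose, hPs, Matrix.mul_assoc]
  have key : ∑ k, ∑ l, (P * (Jᵀ * H i) * P) k l * H k γ l =
      (∑ s, (∑ l, B s l • H l) * (P * Jᵀ) * (∑ l, B s l • H l)) γ i := by
    rw [← sum_smul_mul_mul hB]
    simp only [Matrix.sum_apply, Matrix.smul_apply, smul_eq_mul]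
    -- Symmetry of second derivatives moves the free index `i` out of `H` and into a column
    -- position.
    have hq : ∀ k q, (P * (Jᵀ * H i)) k q = (P * Jᵀ * H q) k i := fun k q => by
      rw [← Matrix.mul_assoc, Matrix.mul_apply, Matrix.mul_apply]
      exact Finset.sum_congr rfl fun β _ => by rw [hH]
    calc ∑ k, ∑ l, (P * (Jᵀ * H i) * P) k l * H k γ l
        = ∑ k, ∑ l, ∑ q, (P * Jᵀ * H q) k i * P q l * H l γ k := by
          refine Finset.sum_congr rfl fun k _ => Finset.sum_congr rfl fun l _ => ?_
          rw [Matrix.mul_apply, Finset.sum_mul, hH k γ l]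
          exact Finset.sum_congr rfl fun q _ => by rw [hq]
      _ = ∑ l, ∑ q, ∑ k, (P * Jᵀ * H q) k i * P q l * H l γ k := by
          rw [Finset.sum_comm]
          exact Finset.sum_congr rfl fun l _ => Finset.sum_comm
      _ = _ := by
          refine Finset.sum_congr rfl fun l _ => Finset.sum_congr rfl fun q _ => ?_
          have hp : P q l = P l q := congrFun₂ hPs l q
          rw [Matrix.mul_assoc (H l), Matrix.mul_apply, Finset.mul_sum]
          exact Finset.sum_congr rfl fun k _ => by rw [hp]; ring
  -- The two halves are transposes of each other, and `H` is symmetric in `k, l`: hence the factor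
  -- `2`.
  have h2 : ∑ k, ∑ l, (P * ((H i)ᵀ * J) * P) k l * H k γ l =
      ∑ k, ∑ l, (P * (Jᵀ * H i) * P) k l * H k γ l := by
    rw [Finset.sum_comm]
    exact Finset.sum_congr rfl fun k _ => Finset.sum_congr rfl fun l _ => by rw [hsym, hH]
  simp only [Matrix.mul_add, Matrix.add_apply, add_mul, Finset.sum_add_distrib]
  rw [h2, key]
  ring

/-- The pointwise inequality behind the superharmonicity of `log det g` on maximal graphs. -/
lemma contracted_hessian_nonpos {P : Matrix (Fin m) (Fin m) ℝ} (hP : P.PosSemidef)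
    (J : Matrix (Fin n) (Fin m) ℝ) (H : Fin m → Matrix (Fin n) (Fin m) ℝ)
    (T : Fin m → Fin m → Matrix (Fin n) (Fin m) ℝ)
    (hH : ∀ k γ l, H k γ l = H l γ k) (hT : ∀ i k γ l, T i k γ l = T k l γ i)
    (D : Fin m → Matrix (Fin m) (Fin m) ℝ) (hD : ∀ k, D k = -((H k)ᵀ * J + Jᵀ * H k))
    (heq : ∀ i γ, ∑ k, ∑ l, ((-(P * D i * P)) k l * H k γ l + P k l * T i k γ l) = 0) :
    ∑ l, ∑ k, P l k * ((-(P * D l * P) * D k).trace + (P * -((T l k)ᵀ * J + (H k)ᵀ * H l +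
      ((H l)ᵀ * H k + Jᵀ * T l k))).trace) ≤ 0 := by
  obtain ⟨B, hB⟩ := exists_transpose_mul_self hP
  have hPs : Pᵀ = P := by rw [hB]; simp
  set K : Fin m → Matrix (Fin n) (Fin m) ℝ := fun s => ∑ l, B s l • H l with hK
  set Θ : Matrix (Fin n) (Fin m) ℝ := ∑ l, ∑ k, P l k • T l k with hΘ
  -- The differentiated equation `heq` removes the third derivatives: their contraction is quadratic
  -- in second derivatives.
  have hΘ' : Θ = -(2 : ℝ) • ∑ s, K s * (P * Jᵀ) * K s := by
    ext γ i
    have h1 := heq i γ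
    simp only [Finset.sum_add_distrib] at h1
    have h2 := contracted_third_derivative hB J H hH i γ
    have h3 : ∀ k l, (-(P * D i * P)) k l = (P * ((H i)ᵀ * J + Jᵀ * H i) * P) k l := fun k l => by
      rw [hD]; simp only [Matrix.mul_neg, Matrix.neg_mul, neg_neg]
    simp only [h3] at h1
    rw [h2] at h1
    have h4 : Θ γ i = ∑ k, ∑ l, P k l * T i k γ l := by
      simp only [hΘ, Matrix.sum_apply, Matrix.smul_apply, smul_eq_mul]
      exact Finset.sum_congr rfl fun k _ => Finset.sum_congr rfl fun l _ => by rw [← hT]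
    rw [h4, Matrix.smul_apply, smul_eq_mul]
    linarith
  have hDs : ∀ s, (∑ l, B s l • D l) = -((K s)ᵀ * J + Jᵀ * K s) := fun s => by
    simp only [hD, hK, Matrix.transpose_sum, Matrix.transpose_smul, Matrix.sum_mul,
      Matrix.mul_sum, Matrix.smul_mul, Matrix.mul_smul, smul_neg, smul_add,
      Finset.sum_add_distrib, Finset.sum_neg_distrib]
  have hKs : ∀ s, (∑ l, B s l • (H l)ᵀ) = (K s)ᵀ := fun s => by
    simp only [hK, Matrix.transpose_sum, Matrix.transpose_smul]
  have hHs : ∀ s, (∑ l, B s l • H l) = K s := fun s => rfl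
  have t1 : ∑ l, ∑ k, P l k * (-(P * D l * P) * D k).trace =
      -∑ s, (P * ((K s)ᵀ * J + Jᵀ * K s) * P * ((K s)ᵀ * J + Jᵀ * K s)).trace := by
    have h0 := sum_smul_mul_mul hB D P D
    simp only [hDs, Matrix.neg_mul, Matrix.mul_neg, neg_neg] at h0
    have := congrArg (fun M => (P * M).trace) h0
    simp only [Matrix.mul_sum, Matrix.trace_sum, Matrix.mul_smul, Matrix.trace_smul,
      smul_eq_mul] at this
    simp only [Matrix.neg_mul, Matrix.trace_neg, mul_neg, Finset.sum_neg_distrib, neg_inj]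
    simp only [Matrix.mul_assoc] at this ⊢
    exact this
  have t3 : ∑ l, ∑ k, P l k * (P * ((H l)ᵀ * H k)).trace = ∑ s, (P * ((K s)ᵀ * K s)).trace := by
    have h0 := sum_smul_mul_mul hB (fun l => (H l)ᵀ) 1 H
    simp only [hKs, hHs, Matrix.mul_one] at h0
    have := congrArg (fun M => (P * M).trace) h0
    simpa only [Matrix.mul_sum, Matrix.trace_sum, Matrix.mul_smul, Matrix.trace_smul,
      smul_eq_mul] using this
  have t2 : ∑ l, ∑ k, P l k * (P * ((H k)ᵀ * H l)).trace = ∑ s, (P * ((K s)ᵀ * K s)).trace := by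
    rw [Finset.sum_comm, ← t3]
    exact Finset.sum_congr rfl fun l _ => Finset.sum_congr rfl fun k _ =>
      congrArg (· * _) (congrFun₂ hPs l k)
  have t4 : ∑ l, ∑ k, P l k * (P * (Jᵀ * T l k)).trace = (P * (Jᵀ * Θ)).trace := by
    simp only [hΘ, Matrix.mul_sum, Matrix.trace_sum, Matrix.mul_smul, Matrix.trace_smul,
      smul_eq_mul]
  have t5 : ∑ l, ∑ k, P l k * (P * ((T l k)ᵀ * J)).trace = (P * (Jᵀ * Θ)).trace := by
    rw [← t4]
    refine Finset.sum_congr rfl fun l _ => Finset.sum_congr rfl fun k _ => ?_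
    rw [← Matrix.trace_transpose (P * (Jᵀ * T l k))]
    simp only [Matrix.transpose_mul, Matrix.transpose_transpose, hPs]
    rw [Matrix.trace_mul_comm P]
  have t6 : (P * (Jᵀ * Θ)).trace = -2 * ∑ s, (P * (Jᵀ * K s) * P * (Jᵀ * K s)).trace := by
    rw [hΘ']
    simp only [Matrix.mul_smul, Matrix.trace_smul, Matrix.mul_sum, Matrix.trace_sum, smul_eq_mul,
      Matrix.mul_assoc]
  have t7 : ∀ s, (P * ((K s)ᵀ * J + Jᵀ * K s) * P * ((K s)ᵀ * J + Jᵀ * K s)).trace =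
      2 * (P * (Jᵀ * K s) * P * (Jᵀ * K s)).trace +
        2 * (P * (Jᵀ * K s) * P * (Jᵀ * K s)ᵀ).trace := fun s => by
    set N := Jᵀ * K s
    have hN : (K s)ᵀ * J = Nᵀ := by simp [N]
    have e3 : (P * Nᵀ * P * Nᵀ).trace = (P * N * P * N).trace := by
      rw [← Matrix.trace_transpose]
      simp only [Matrix.transpose_mul, Matrix.transpose_transpose, hPs]
      rw [show N * (P * (N * P)) = (N * (P * N)) * P by simp only [Matrix.mul_assoc],
        Matrix.trace_mul_comm]
      simp only [Matrix.mul_assoc]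
    have e2 : (P * Nᵀ * P * N).trace = (P * N * P * Nᵀ).trace := by
      rw [show P * Nᵀ * P * N = (P * Nᵀ) * (P * N) by simp only [Matrix.mul_assoc],
        Matrix.trace_mul_comm]
      simp only [Matrix.mul_assoc]
    rw [hN]
    simp only [Matrix.mul_add, Matrix.add_mul, Matrix.trace_add]
    rw [e2, e3]; ring
  have hpos : ∀ s, 0 ≤ (P * ((K s)ᵀ * K s)).trace := fun s => by
    have := (hP.mul_mul_conjTranspose_same (K s)).trace_nonneg
    rwa [Matrix.conjTranspose_eq_transpose_of_trivial, Matrix.mul_assoc, Matrix.trace_mul_comm,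
      Matrix.mul_assoc] at this
  simp only [Matrix.trace_neg, Matrix.trace_add, mul_add, neg_add,
    mul_neg, Finset.sum_add_distrib, Finset.sum_neg_distrib]
  -- With `N_s = JᵀK_s`, put `a = ∑ tr(P N_s P N_s)`, `b = ∑ tr(P N_s P N_sᵀ)`, `c = ∑ tr(P
  -- K_sᵀK_s)`. The total is `-(2a + 2b) + 4a - 2c = 2(a - b) - 2c`, where `a ≤ b` and `c ≥ 0`.
  rw [t1, t2, t3, t4, t5, t6]
  simp only [t7, Finset.sum_add_distrib, ← Finset.mul_sum]
  have f1 := Finset.sum_le_sum fun s (_ : s ∈ Finset.univ) => trace_sq_le (N := Jᵀ * K s) hP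
  have f2 := Finset.sum_nonneg fun s (_ : s ∈ Finset.univ) => hpos s
  linarith

end PointwiseInequality

/-! ### Second-order conditions at a local minimum. -/

section SecondDerivativeTest

variable {m : ℕ}

lemma hasDerivAt_comp_line {G : Type*} [NormedAddCommGroup G] [NormedSpace ℝ G] {F : E m → G}
    {x v : E m} {t : ℝ} (hF : DifferentiableAt ℝ F (x + t • v)) :
    HasDerivAt (fun s : ℝ => F (x + s • v)) (fderiv ℝ F (x + t • v) v) t := by
  have h1 : HasDerivAt (fun s : ℝ => x + s • v) v t := by
    simpa using ((hasDerivAt_id t).smul_const v).const_add x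
  exact hF.hasFDerivAt.comp_hasDerivAt t h1

lemma second_fderiv_nonneg_of_isLocalMin {F : E m → ℝ} {x : E m} (hF : ContDiffAt ℝ 2 F x)
    (hmin : IsLocalMin F x) (v : E m) : 0 ≤ fderiv ℝ (fderiv ℝ F) x v v := by
  set f : ℝ → ℝ := fun t => F (x + t • v) with hf
  have hline : Filter.Tendsto (fun t : ℝ => x + t • v) (𝓝 0) (𝓝 x) := by
    have : Continuous fun t : ℝ => x + t • v := by fun_prop
    simpa using this.tendsto 0
  have hd : ∀ᶠ t in 𝓝 (0 : ℝ), deriv f t = fderiv ℝ F (x + t • v) v := by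
    have := hF.eventually (by simp)
    filter_upwards [hline.eventually this] with t ht
    exact (hasDerivAt_comp_line (ht.differentiableAt (by simp))).deriv
  have hd1 : DifferentiableAt ℝ (fderiv ℝ F) x :=
    (hF.fderiv_right (m := 1) (by norm_num)).differentiableAt (by simp)
  have hdd : deriv (deriv f) 0 = fderiv ℝ (fderiv ℝ F) x v v := by
    rw [Filter.EventuallyEq.deriv_eq hd]
    have h0 : DifferentiableAt ℝ (fderiv ℝ F) (x + (0 : ℝ) • v) := by simpa using hd1
    have := (hasDerivAt_comp_line h0).clm_apply (hasDerivAt_const (0 : ℝ) v)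
    simpa using this.deriv
  have hfmin : IsLocalMin f 0 := by
    have := hline.eventually hmin
    filter_upwards [this] with t ht
    simpa [hf] using ht
  by_contra! hneg
  have hcont : ContinuousAt f 0 := by
    have h0 : DifferentiableAt ℝ F (x + (0 : ℝ) • v) := by
      simpa using hF.differentiableAt (by simp)
    exact (hasDerivAt_comp_line h0).continuousAt
  -- A negative second derivative would make the minimum along the line a maximum as well; `f` would
  -- then be locally constant and its second derivative zero.
  have hmax : IsLocalMax f 0 :=
    isLocalMax_of_deriv_deriv_neg (by rw [hdd]; exact hneg) hfmin.deriv_eq_zero hcont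
  have hconst : f =ᶠ[𝓝 0] fun _ => f 0 := by
    filter_upwards [hmax, hfmin] with t h1 h2 using le_antisymm h1 h2
  have : deriv (deriv f) 0 = 0 := by
    rw [hconst.deriv.deriv_eq]
    simp
  rw [hdd] at this
  exact hneg.ne this

/-- Only diagonal values of `β` remain on the right. These are what the second-derivative test and
`supNorm₂` control. -/
lemma sum_gram_bilinear {G : Type*} [NormedAddCommGroup G] [NormedSpace ℝ G]
    {P B : Matrix (Fin m) (Fin m) ℝ} (hB : P = Bᵀ * B)
    (β : E m →L[ℝ] E m →L[ℝ] G) :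
    ∑ l, ∑ k, P l k • β (stdVec l) (stdVec k) =
      ∑ s, β (WithLp.toLp 2 (B s)) (WithLp.toLp 2 (B s)) := by
  have hb : ∀ s, (WithLp.toLp 2 (B s) : E m) = ∑ l, B s l • stdVec l := fun s => by
    ext i
    simp [stdVec, Finset.sum_apply, Pi.single_apply]
  simp only [hb, map_sum, map_smul, sum_apply, smul_apply,
    Finset.smul_sum, smul_smul, hB, Matrix.mul_apply, Matrix.transpose_apply, Finset.sum_smul]
  calc _ = ∑ l, ∑ s, ∑ k, (B s l * B s k) • β (stdVec l) (stdVec k) :=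
        Finset.sum_congr rfl fun _ _ => Finset.sum_comm
    _ = ∑ s, ∑ l, ∑ k, (B s l * B s k) • β (stdVec l) (stdVec k) := Finset.sum_comm
    _ = _ := Finset.sum_congr rfl fun s _ => by
        rw [Finset.sum_comm]
        exact Finset.sum_congr rfl fun x _ => Finset.sum_congr rfl fun y _ => by rw [mul_comm]

lemma contracted_hessian_nonneg_of_isLocalMin {F : E m → ℝ} {x : E m} (hF : ContDiffAt ℝ 2 F x)
    (hmin : IsLocalMin F x) {P : Matrix (Fin m) (Fin m) ℝ} (hP : P.PosSemidef) :
    0 ≤ ∑ l, ∑ k, P l k • fderiv ℝ (fderiv ℝ F) x (stdVec l) (stdVec k) := by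
  obtain ⟨B, hB⟩ := exists_transpose_mul_self hP
  rw [sum_gram_bilinear hB]
  exact Finset.sum_nonneg fun s _ => second_fderiv_nonneg_of_isLocalMin hF hmin _

end SecondDerivativeTest

/-! ### Entrywise calculus of matrix-valued functions. -/

section MatrixCalculus

variable {m a b c : ℕ}

/-- Entrywise directional derivative of a matrix-valued function. -/
noncomputable def matrixDeriv (v : E m) (M : E m → Matrix (Fin a) (Fin b) ℝ) (x : E m) :
    Matrix (Fin a) (Fin b) ℝ :=
  Matrix.of fun i j => fderiv ℝ (fun y => M y i j) x v

/-- Entrywise smoothness of a matrix-valued function. -/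
def SmoothEntries (Ω : Set (E m)) (M : E m → Matrix (Fin a) (Fin b) ℝ) : Prop :=
  ∀ i j, ContDiffOn ℝ ∞ (fun y => M y i j) Ω

variable {Ω : Set (E m)} {M : E m → Matrix (Fin a) (Fin b) ℝ} {N : E m → Matrix (Fin b) (Fin c) ℝ}
  {v w x : E m}

lemma SmoothEntries.differentiableAt (hM : SmoothEntries Ω M) (hΩ : IsOpen Ω) (hx : x ∈ Ω)
    (i : Fin a) (j : Fin b) : DifferentiableAt ℝ (fun y => M y i j) x :=
  ((hM i j).contDiffAt (hΩ.mem_nhds hx)).differentiableAt (by simp)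

lemma SmoothEntries.transpose (hM : SmoothEntries Ω M) : SmoothEntries Ω fun y => (M y)ᵀ :=
  fun i j => hM j i

lemma SmoothEntries.mul (hM : SmoothEntries Ω M) (hN : SmoothEntries Ω N) :
    SmoothEntries Ω fun y => M y * N y := fun i j => by
  simp only [Matrix.mul_apply]
  exact ContDiffOn.sum fun k _ => (hM i k).mul (hN k j)

lemma contDiffOn_fderiv_apply {f : E m → ℝ} (hΩ : IsOpen Ω) (hf : ContDiffOn ℝ ∞ f Ω) (v : E m) :
    ContDiffOn ℝ ∞ (fun y => fderiv ℝ f y v) Ω :=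
  (hf.fderiv_of_isOpen hΩ (m := ∞) (by simp)).clm_apply contDiffOn_const

lemma SmoothEntries.matrixDeriv (hΩ : IsOpen Ω) (hM : SmoothEntries Ω M) (v : E m) :
    SmoothEntries Ω (matrixDeriv v M) := fun i j => contDiffOn_fderiv_apply hΩ (hM i j) v

lemma matrixDeriv_congr {M' : E m → Matrix (Fin a) (Fin b) ℝ} (hΩ : IsOpen Ω) (hx : x ∈ Ω)
    (h : ∀ y ∈ Ω, M y = M' y) : matrixDeriv v M x = matrixDeriv v M' x := by
  ext i j
  have : (fun y => M y i j) =ᶠ[𝓝 x] fun y => M' y i j := by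
    filter_upwards [hΩ.mem_nhds hx] with y hy
    rw [h y hy]
  simp only [matrixDeriv, Matrix.of_apply, this.fderiv_eq]

lemma matrixDeriv_mul (hΩ : IsOpen Ω) (hx : x ∈ Ω) (hM : SmoothEntries Ω M)
    (hN : SmoothEntries Ω N) :
    matrixDeriv v (fun y => M y * N y) x = matrixDeriv v M x * N x + M x * matrixDeriv v N x := by
  ext i j
  simp only [matrixDeriv, Matrix.of_apply, Matrix.mul_apply, Matrix.add_apply]
  have h1 := fun k => hM.differentiableAt hΩ hx i k
  have h2 := fun k => hN.differentiableAt hΩ hx k j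
  rw [fderiv_fun_sum fun k _ => (h1 k).fun_mul (h2 k), sum_apply,
    ← Finset.sum_add_distrib]
  refine Finset.sum_congr rfl fun k _ => ?_
  rw [fderiv_fun_mul (h1 k) (h2 k)]
  simp only [add_apply, smul_apply, smul_eq_mul]
  ring

lemma matrixDeriv_transpose : matrixDeriv v (fun y => (M y)ᵀ) x = (matrixDeriv v M x)ᵀ := rfl

lemma matrixDeriv_add {M' : E m → Matrix (Fin a) (Fin b) ℝ} (hΩ : IsOpen Ω) (hx : x ∈ Ω)
    (hM : SmoothEntries Ω M) (hM' : SmoothEntries Ω M') :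
    matrixDeriv v (fun y => M y + M' y) x = matrixDeriv v M x + matrixDeriv v M' x := by
  ext i j
  simp only [matrixDeriv, Matrix.of_apply, Matrix.add_apply]
  rw [fderiv_fun_add (hM.differentiableAt hΩ hx i j) (hM'.differentiableAt hΩ hx i j)]
  rfl

lemma matrixDeriv_neg : matrixDeriv v (fun y => -M y) x = -matrixDeriv v M x := by
  ext i j
  simp [matrixDeriv, fderiv_fun_neg]

lemma matrixDeriv_const_sub (C : Matrix (Fin a) (Fin b) ℝ) :
    matrixDeriv v (fun y => C - M y) x = -matrixDeriv v M x := by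
  ext i j
  simp [matrixDeriv, fderiv_const_sub]

lemma fderiv_fderiv_apply {f : E m → ℝ} (hf : ContDiffAt ℝ 2 f x) (v w : E m) :
    fderiv ℝ (fun y => fderiv ℝ f y w) x v = fderiv ℝ (fderiv ℝ f) x v w := by
  have hd1 : DifferentiableAt ℝ (fderiv ℝ f) x :=
    (hf.fderiv_right (m := 1) (by norm_num)).differentiableAt (by simp)
  rw [fderiv_clm_apply hd1 (differentiableAt_const w)]
  simp

lemma matrixDeriv_comm (hΩ : IsOpen Ω) (hx : x ∈ Ω) (hM : SmoothEntries Ω M) :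
    matrixDeriv v (matrixDeriv w M) x = matrixDeriv w (matrixDeriv v M) x := by
  ext i j
  have h : ContDiffAt ℝ 2 (fun y => M y i j) x :=
    ((hM i j).contDiffAt (hΩ.mem_nhds hx)).of_le (WithTop.coe_le_coe.2 le_top)
  simp only [matrixDeriv, Matrix.of_apply]
  rw [fderiv_fderiv_apply h, fderiv_fderiv_apply h]
  exact h.isSymmSndFDerivAt (by simp) v w

lemma fderiv_trace {M : E m → Matrix (Fin a) (Fin a) ℝ} (hΩ : IsOpen Ω) (hx : x ∈ Ω)
    (hM : SmoothEntries Ω M) :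
    fderiv ℝ (fun y => (M y).trace) x v = (matrixDeriv v M x).trace := by
  simp only [Matrix.trace, Matrix.diag]
  rw [fderiv_fun_sum fun k _ => hM.differentiableAt hΩ hx k k, sum_apply]
  rfl

lemma SmoothEntries.det {M : E m → Matrix (Fin a) (Fin a) ℝ} (hM : SmoothEntries Ω M) :
    ContDiffOn ℝ ∞ (fun y => (M y).det) Ω := by
  simp only [Matrix.det_apply']
  exact ContDiffOn.sum fun σ _ => contDiffOn_const.mul (contDiffOn_prod fun i _ => hM _ _)

lemma SmoothEntries.adjugate {M : E m → Matrix (Fin a) (Fin a) ℝ} (hM : SmoothEntries Ω M) :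
    SmoothEntries Ω fun y => (M y).adjugate := fun i j => by
  simp only [Matrix.adjugate_apply]
  refine SmoothEntries.det fun k l => ?_
  by_cases h : k = j
  · subst h; simpa using contDiffOn_const
  · simpa [Matrix.updateRow_ne h] using hM k l

lemma SmoothEntries.inv {M : E m → Matrix (Fin a) (Fin a) ℝ} (hM : SmoothEntries Ω M)
    (hdet : ∀ y ∈ Ω, (M y).det ≠ 0) : SmoothEntries Ω fun y => (M y)⁻¹ := fun i j => by
  simp only [Matrix.inv_def, Matrix.smul_apply, smul_eq_mul, Ring.inverse_eq_inv']
  exact (hM.det.inv hdet).mul (hM.adjugate i j)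

lemma matrixDeriv_inv {M : E m → Matrix (Fin a) (Fin a) ℝ} (hΩ : IsOpen Ω) (hx : x ∈ Ω)
    (hM : SmoothEntries Ω M) (hdet : ∀ y ∈ Ω, (M y).det ≠ 0) :
    matrixDeriv v (fun y => (M y)⁻¹) x = -((M x)⁻¹ * matrixDeriv v M x * (M x)⁻¹) := by
  have h1 := matrixDeriv_congr (v := v) (M := fun y => (M y)⁻¹ * M y) (M' := fun _ => 1) hΩ hx
    fun y hy => Matrix.nonsing_inv_mul _ (hdet y hy).isUnit
  have h2 : matrixDeriv v (fun _ : E m => (1 : Matrix (Fin a) (Fin a) ℝ)) x = 0 := by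
    ext i j; simp [matrixDeriv]
  rw [h2, matrixDeriv_mul hΩ hx (hM.inv hdet) hM] at h1
  have h3 := congrArg (· * (M x)⁻¹) h1
  simp only [Matrix.add_mul, Matrix.zero_mul] at h3
  rw [Matrix.mul_assoc, Matrix.mul_nonsing_inv _ (hdet x hx).isUnit, Matrix.mul_one] at h3
  exact eq_neg_of_add_eq_zero_left h3

/-- The Jacobi formula for the derivative of a determinant. -/
lemma fderiv_det {M : E m → Matrix (Fin a) (Fin a) ℝ} (hΩ : IsOpen Ω) (hx : x ∈ Ω)
    (hM : SmoothEntries Ω M) :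
    fderiv ℝ (fun y => (M y).det) x v = ((M x).adjugate * matrixDeriv v M x).trace := by
  have hd := fun i j => (hM.differentiableAt hΩ hx i j).hasFDerivAt
  have h1 : HasFDerivAt (fun y => (M y).det)
      (∑ σ : Equiv.Perm (Fin a), ((Equiv.Perm.sign σ : ℤ) : ℝ) •
        ∑ i, (∏ j ∈ Finset.univ.erase i, M x (σ j) j) • fderiv ℝ (fun y => M y (σ i) i) x) x := by
    simp only [Matrix.det_apply']
    exact HasFDerivAt.fun_sum fun σ _ =>
      (HasFDerivAt.finsetProd fun i _ => hd (σ i) i).const_mul _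
  rw [h1.fderiv]
  -- By Cramer's rule a diagonal entry is the determinant with column `i` differentiated; its
  -- Leibniz expansion matches the product rule in `h1`.
  have h2 : ∀ i, ((M x).adjugate * matrixDeriv v M x) i i =
      ((M x).updateCol i fun k => matrixDeriv v M x k i).det := fun i => by
    rw [← Matrix.cramer_apply, Matrix.cramer_eq_adjugate_mulVec]
    rfl
  simp only [Matrix.trace, Matrix.diag, h2, Matrix.det_apply', sum_apply,
    smul_apply, smul_eq_mul, Finset.mul_sum]
  rw [Finset.sum_comm]
  refine Finset.sum_congr rfl fun i _ => Finset.sum_congr rfl fun σ _ => ?_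
  rw [← Finset.mul_prod_erase _ _ (Finset.mem_univ i)]
  congr 1
  rw [Matrix.updateCol_self, mul_comm]
  congr 1
  exact Finset.prod_congr rfl fun j hj => by rw [Matrix.updateCol_ne (Finset.ne_of_mem_erase hj)]

lemma fderiv_log_det {M : E m → Matrix (Fin a) (Fin a) ℝ} (hΩ : IsOpen Ω) (hx : x ∈ Ω)
    (hM : SmoothEntries Ω M) (hdet : (M x).det ≠ 0) :
    fderiv ℝ (fun y => Real.log (M y).det) x v = ((M x)⁻¹ * matrixDeriv v M x).trace := by
  have hd : DifferentiableAt ℝ (fun y => (M y).det) x :=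
    (hM.det.contDiffAt (hΩ.mem_nhds hx)).differentiableAt (by simp)
  rw [fderiv.log hd hdet, smul_apply, fderiv_det hΩ hx hM, Matrix.inv_def,
    Matrix.smul_mul, Matrix.trace_smul, Ring.inverse_eq_inv']

end MatrixCalculus

/-! ### Superharmonicity of `log det g` on a maximal graph. -/

section LogDet

variable {m n : ℕ} {Ω : Set (E m)} {u : E m → E n}

lemma contDiffAt_two_of_smooth {G : Type*} [NormedAddCommGroup G] [NormedSpace ℝ G] {f : E m → G}
    (hΩ : IsOpen Ω) (hf : ContDiffOn ℝ ∞ f Ω) {x : E m} (hx : x ∈ Ω) : ContDiffAt ℝ 2 f x :=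
  (hf.contDiffAt (hΩ.mem_nhds hx)).of_le (WithTop.coe_le_coe.2 le_top)

lemma contDiffOn_apply {f : E m → E n} (hf : ContDiffOn ℝ ∞ f Ω) (γ : Fin n) :
    ContDiffOn ℝ ∞ (fun y => f y γ) Ω :=
  (EuclideanSpace.proj (𝕜 := ℝ) γ).contDiff.comp_contDiffOn hf

lemma fderiv_coord {f : E m → E n} {x : E m} (hf : DifferentiableAt ℝ f x) (γ : Fin n) (v : E m) :
    fderiv ℝ (fun y => f y γ) x v = fderiv ℝ f x v γ := by
  have := ((EuclideanSpace.proj (𝕜 := ℝ) γ).hasFDerivAt.comp x hf.hasFDerivAt).fderiv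
  exact congrArg (fun L => L v) this

lemma smoothEntries_jacobian (hΩ : IsOpen Ω) (hu : ContDiffOn ℝ ∞ u Ω) :
    SmoothEntries Ω (jacobian u) := fun γ i =>
  contDiffOn_apply ((hu.fderiv_of_isOpen hΩ (m := ∞) (by simp)).clm_apply contDiffOn_const) γ

lemma smoothEntries_inducedMetric (hΩ : IsOpen Ω) (hu : ContDiffOn ℝ ∞ u Ω) :
    SmoothEntries Ω (inducedMetric u) := fun i j =>
  contDiffOn_const.sub
    (((smoothEntries_jacobian hΩ hu).transpose.mul (smoothEntries_jacobian hΩ hu)) i j)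

lemma matrixDeriv_jacobian (hΩ : IsOpen Ω) (hu : ContDiffOn ℝ ∞ u Ω) {x : E m} (hx : x ∈ Ω)
    (v : E m) (γ : Fin n) (l : Fin m) :
    matrixDeriv v (jacobian u) x γ l = fderiv ℝ (fderiv ℝ u) x v (stdVec l) γ := by
  have h2 := contDiffAt_two_of_smooth hΩ hu hx
  have hd1 : DifferentiableAt ℝ (fderiv ℝ u) x :=
    (h2.fderiv_right (m := 1) (by norm_num)).differentiableAt (by simp)
  simp only [matrixDeriv, jacobian, Matrix.of_apply]
  rw [fderiv_coord (hd1.clm_apply (differentiableAt_const _)),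
    fderiv_clm_apply hd1 (differentiableAt_const _)]
  simp

lemma matrixDeriv_jacobian_symm (hΩ : IsOpen Ω) (hu : ContDiffOn ℝ ∞ u Ω) {x : E m} (hx : x ∈ Ω)
    (k : Fin m) (γ : Fin n) (l : Fin m) :
    matrixDeriv (stdVec k) (jacobian u) x γ l = matrixDeriv (stdVec l) (jacobian u) x γ k := by
  rw [matrixDeriv_jacobian hΩ hu hx, matrixDeriv_jacobian hΩ hu hx,
    (contDiffAt_two_of_smooth hΩ hu hx).isSymmSndFDerivAt (by simp) (stdVec k) (stdVec l)]

lemma matrixDeriv_entry {a b : ℕ} {M : E m → Matrix (Fin a) (Fin b) ℝ} (v x : E m) (i : Fin a)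
    (j : Fin b) : matrixDeriv v M x i j = fderiv ℝ (fun y => M y i j) x v := rfl

/-- The cyclic shift is two transpositions: commuting the outer derivatives, then symmetry of `D²u`
in a neighbourhood of `x`. -/
lemma third_deriv_symm (hΩ : IsOpen Ω) (hu : ContDiffOn ℝ ∞ u Ω) {x : E m} (hx : x ∈ Ω)
    (i k : Fin m) (γ : Fin n) (l : Fin m) :
    matrixDeriv (stdVec i) (matrixDeriv (stdVec k) (jacobian u)) x γ l =
      matrixDeriv (stdVec k) (matrixDeriv (stdVec l) (jacobian u)) x γ i := by
  rw [matrixDeriv_comm hΩ hx (smoothEntries_jacobian hΩ hu), matrixDeriv_entry, matrixDeriv_entry]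
  have : (fun y => matrixDeriv (stdVec i) (jacobian u) y γ l) =ᶠ[𝓝 x]
      fun y => matrixDeriv (stdVec l) (jacobian u) y γ i := by
    filter_upwards [hΩ.mem_nhds hx] with y hy using matrixDeriv_jacobian_symm hΩ hu hy _ _ _
  rw [this.fderiv_eq]

lemma maximalOperator_apply (hΩ : IsOpen Ω) (hu : ContDiffOn ℝ ∞ u Ω) {x : E m} (hx : x ∈ Ω)
    (γ : Fin n) : maximalOperator u x γ =
      ∑ k, ∑ l, (inducedMetric u x)⁻¹ k l * matrixDeriv (stdVec k) (jacobian u) x γ l := by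
  simp [maximalOperator, iteratedFDeriv_two_apply, matrixDeriv_jacobian hΩ hu hx]

lemma matrixDeriv_inducedMetric (hΩ : IsOpen Ω) (hu : ContDiffOn ℝ ∞ u Ω) {x : E m} (hx : x ∈ Ω)
    (v : E m) : matrixDeriv v (inducedMetric u) x =
      -((matrixDeriv v (jacobian u) x)ᵀ * jacobian u x +
        (jacobian u x)ᵀ * matrixDeriv v (jacobian u) x) := by
  have hJ := smoothEntries_jacobian hΩ hu
  rw [show inducedMetric u = fun y => 1 - (jacobian u y)ᵀ * jacobian u y from rfl,
    matrixDeriv_const_sub, matrixDeriv_mul hΩ hx hJ.transpose hJ, matrixDeriv_transpose]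

/-- On a maximal graph, `log det g` is superharmonic: `g^{kl} ∂_k ∂_l log det g ≤ 0`. -/
theorem contracted_hessian_log_det_nonpos (hΩ : IsOpen Ω) (hu : ContDiffOn ℝ ∞ u Ω)
    (hmax : ∀ x ∈ Ω, maximalOperator u x = 0) (hpos : ∀ x ∈ Ω, (inducedMetric u x).PosDef)
    {x : E m} (hx : x ∈ Ω) :
    ∑ l, ∑ k, (inducedMetric u x)⁻¹ l k •
      fderiv ℝ (fderiv ℝ fun y => Real.log (inducedMetric u y).det) x (stdVec l) (stdVec k) ≤ 0 := by
  have hJ := smoothEntries_jacobian hΩ hu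
  have hg := smoothEntries_inducedMetric hΩ hu
  have hdet : ∀ y ∈ Ω, (inducedMetric u y).det ≠ 0 := fun y hy => (hpos y hy).det_pos.ne'
  have hP := hg.inv hdet
  have hlog : ContDiffOn ℝ ∞ (fun y => Real.log (inducedMetric u y).det) Ω := hg.det.log hdet
  set H : Fin m → E m → Matrix (Fin n) (Fin m) ℝ := fun k => matrixDeriv (stdVec k) (jacobian u)
    with hHdef
  have hHs : ∀ k, SmoothEntries Ω (H k) := fun k => hJ.matrixDeriv hΩ _
  set D : Fin m → E m → Matrix (Fin m) (Fin m) ℝ :=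
    fun k => matrixDeriv (stdVec k) (inducedMetric u) with hDdef
  have hDs : ∀ k, SmoothEntries Ω (D k) := fun k => hg.matrixDeriv hΩ _
  have key := contracted_hessian_nonpos (hpos x hx).inv.posSemidef (jacobian u x)
    (fun k => H k x) (fun l k => matrixDeriv (stdVec l) (H k) x)
    (fun k γ l => matrixDeriv_jacobian_symm hΩ hu hx k γ l)
    (fun i k γ l => third_deriv_symm hΩ hu hx i k γ l)
    (fun k => D k x) (fun k => matrixDeriv_inducedMetric hΩ hu hx _) ?_
  · refine le_of_eq_of_le ?_ key
    refine Finset.sum_congr rfl fun l _ => Finset.sum_congr rfl fun k _ => ?_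
    rw [smul_eq_mul]
    congr 1
    rw [← fderiv_fderiv_apply (contDiffAt_two_of_smooth hΩ hlog hx)]
    have h1 : (fun y => fderiv ℝ (fun y => Real.log (inducedMetric u y).det) y (stdVec k)) =ᶠ[𝓝 x]
        fun y => ((inducedMetric u y)⁻¹ * D k y).trace := by
      filter_upwards [hΩ.mem_nhds hx] with y hy using fderiv_log_det hΩ hy hg (hdet y hy)
    have h2 : matrixDeriv (stdVec l) (D k) x =
        -((matrixDeriv (stdVec l) (H k) x)ᵀ * jacobian u x + (H k x)ᵀ * H l x +
          ((H l x)ᵀ * H k x + (jacobian u x)ᵀ * matrixDeriv (stdVec l) (H k) x)) := by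
      rw [matrixDeriv_congr hΩ hx fun y hy => matrixDeriv_inducedMetric hΩ hu hy (stdVec k),
        matrixDeriv_neg, matrixDeriv_add hΩ hx ((hHs k).transpose.mul hJ)
          (hJ.transpose.mul (hHs k)), matrixDeriv_mul hΩ hx (hHs k).transpose hJ,
        matrixDeriv_mul hΩ hx hJ.transpose (hHs k)]
      rfl
    rw [h1.fderiv_eq, fderiv_trace hΩ hx (hP.mul (hDs k)), matrixDeriv_mul hΩ hx hP (hDs k),
      matrixDeriv_inv hΩ hx hg hdet, h2, Matrix.trace_add]
  · intro i γ
    -- The equation holds near `x`, so it may be differentiated in direction `i`; the product rule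
    -- gives the required identity.
    have h0 : (fun y => ∑ k, ∑ l, (inducedMetric u y)⁻¹ k l * H k y γ l) =ᶠ[𝓝 x] fun _ => 0 := by
      filter_upwards [hΩ.mem_nhds hx] with y hy
      rw [← maximalOperator_apply hΩ hu hy, hmax y hy]
      rfl
    have h1 : fderiv ℝ (fun y => ∑ k, ∑ l, (inducedMetric u y)⁻¹ k l * H k y γ l) x (stdVec i)
        = 0 := by
      rw [h0.fderiv_eq]; simp
    have hPd := hP.differentiableAt hΩ hx
    have hHd := fun k => (hHs k).differentiableAt hΩ hx γ
    rw [fderiv_fun_sum fun k _ => DifferentiableAt.fun_sum fun l _ =>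
      (hPd k l).fun_mul (hHd k l), sum_apply] at h1
    rw [← h1]
    refine Finset.sum_congr rfl fun k _ => ?_
    rw [fderiv_fun_sum fun l _ => (hPd k l).fun_mul (hHd k l), sum_apply]
    refine Finset.sum_congr rfl fun l _ => ?_
    rw [fderiv_fun_mul (hPd k l) (hHd k l), ← matrixDeriv_inv hΩ hx hg hdet]
    simp only [add_apply, smul_apply, smul_eq_mul, matrixDeriv_entry]
    ring

end LogDet

/-! ### The norms `|||·|||` and the quadratic form of `g`. -/

section SupNorm

variable {m n : ℕ}

lemma supNorm_bddAbove (A : E m →L[ℝ] E n) :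
    BddAbove ((fun v : E m => ‖A v‖) '' sphere (0 : E m) 1) := by
  refine ⟨‖A‖, ?_⟩
  rintro _ ⟨v, hv, rfl⟩
  simpa [mem_sphere_zero_iff_norm.1 hv] using A.le_opNorm v

lemma supNorm_nonneg (A : E m →L[ℝ] E n) : 0 ≤ supNorm A :=
  Real.sSup_nonneg (by rintro _ ⟨v, _, rfl⟩; exact norm_nonneg _)

lemma supNorm_le {A : E m →L[ℝ] E n} {c : ℝ} (hc : 0 ≤ c) (h : ∀ v, ‖A v‖ ≤ c * ‖v‖) :
    supNorm A ≤ c := by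
  refine Real.sSup_le ?_ hc
  rintro _ ⟨v, hv, rfl⟩
  simpa [mem_sphere_zero_iff_norm.1 hv] using h v

lemma norm_apply_le_supNorm (A : E m →L[ℝ] E n) (v : E m) : ‖A v‖ ≤ supNorm A * ‖v‖ := by
  rcases eq_or_ne v 0 with rfl | hv
  · simp
  have hv' : 0 < ‖v‖ := norm_pos_iff.2 hv
  have h : ‖A (‖v‖⁻¹ • v)‖ ≤ supNorm A := le_csSup (supNorm_bddAbove A)
    ⟨‖v‖⁻¹ • v, by simp [norm_smul, hv'.ne'], rfl⟩
  rw [map_smul, norm_smul, norm_inv, norm_norm, inv_mul_le_iff₀ hv'] at h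
  linarith

lemma supNorm₂_bddAbove (B : ContinuousMultilinearMap ℝ (fun _ : Fin 2 => E m) (E n)) :
    ∀ y ∈ (fun v : E m => ‖B ![v, v]‖) '' sphere (0 : E m) 1, y ≤ ‖B‖ := by
  rintro _ ⟨v, hv, rfl⟩
  simpa [mem_sphere_zero_iff_norm.1 hv] using B.le_opNorm ![v, v]

lemma supNorm₂_nonneg (B : ContinuousMultilinearMap ℝ (fun _ : Fin 2 => E m) (E n)) :
    0 ≤ supNorm₂ B :=
  Real.sSup_nonneg (by rintro _ ⟨v, _, rfl⟩; exact norm_nonneg _)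

lemma norm_apply_le_supNorm₂ (B : ContinuousMultilinearMap ℝ (fun _ : Fin 2 => E m) (E n))
    (v : E m) : ‖B ![v, v]‖ ≤ supNorm₂ B * ‖v‖ ^ 2 := by
  rcases eq_or_ne v 0 with rfl | hv
  · have : B ![0, 0] = 0 := B.map_coord_zero 0 rfl
    simp [this]
  have hv' : 0 < ‖v‖ := norm_pos_iff.2 hv
  have h : ‖B ![‖v‖⁻¹ • v, ‖v‖⁻¹ • v]‖ ≤ supNorm₂ B := le_csSup ⟨_, supNorm₂_bddAbove B⟩
    ⟨‖v‖⁻¹ • v, by simp [norm_smul, hv'.ne'], rfl⟩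
  have h2 : ![‖v‖⁻¹ • v, ‖v‖⁻¹ • v] = fun i => (fun _ : Fin 2 => ‖v‖⁻¹) i • (![v, v] : Fin 2 → E m) i := by
    ext i; fin_cases i <;> rfl
  rw [h2, B.map_smul_univ, norm_smul] at h
  simp only [Finset.prod_const, Finset.card_univ, Fintype.card_fin, norm_pow, norm_inv, norm_norm,
    inv_pow] at h
  rw [inv_mul_le_iff₀ (by positivity)] at h
  linarith

/-- The matrix of a linear map in the standard bases. -/
noncomputable def stdMatrix (A : E m →L[ℝ] E n) : Matrix (Fin n) (Fin m) ℝ :=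
  Matrix.of fun γ i => A (stdVec i) γ

lemma stdMatrix_mulVec (A : E m →L[ℝ] E n) (v : Fin m → ℝ) :
    stdMatrix A *ᵥ v = WithLp.ofLp (A (WithLp.toLp 2 v)) := by
  have hv : (WithLp.toLp 2 v : E m) = ∑ l, v l • stdVec l := by
    ext i
    simp [stdVec, Finset.sum_apply, Pi.single_apply]
  rw [hv]
  ext γ
  simp [stdMatrix, Matrix.mulVec, dotProduct, mul_comm]

lemma dotProduct_self_eq_norm_sq {k : ℕ} (v : E k) :
    (WithLp.ofLp v) ⬝ᵥ (WithLp.ofLp v) = ‖v‖ ^ 2 := by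
  rw [EuclideanSpace.real_norm_sq_eq]
  simp [dotProduct, pow_two]

lemma stdMatrix_quadratic (A : E m →L[ℝ] E n) (v : Fin m → ℝ) :
    v ⬝ᵥ (1 - (stdMatrix A)ᵀ * stdMatrix A) *ᵥ v =
      v ⬝ᵥ v - ‖A (WithLp.toLp 2 v)‖ ^ 2 := by
  rw [quadratic_one_sub, stdMatrix_mulVec, dotProduct_self_eq_norm_sq (A _)]

/-- A bound `|||A||| ≤ c` bounds `1 - AᵀA` below. -/
lemma quadratic_ge_of_norm_le {A : E m →L[ℝ] E n} {c : ℝ} (h : ∀ v, ‖A v‖ ≤ c * ‖v‖)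
    (v : Fin m → ℝ) :
    (1 - c ^ 2) * (v ⬝ᵥ v) ≤ v ⬝ᵥ (1 - (stdMatrix A)ᵀ * stdMatrix A) *ᵥ v := by
  have h1 := pow_le_pow_left₀ (norm_nonneg _) (h (WithLp.toLp 2 v)) 2
  have h2 := dotProduct_self_eq_norm_sq (WithLp.toLp 2 v)
  simp only [mul_pow] at h1
  rw [stdMatrix_quadratic]
  rw [← h2] at h1
  linarith

/-- Since `det g ≤ g` as quadratic forms, `d |v|² ≤ |v|² - |Av|²`. This converts a determinant bound
back into a gradient bound. -/
lemma supNorm_sq_le_one_sub_det {A : E m →L[ℝ] E n}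
    (hpos : (1 - (stdMatrix A)ᵀ * stdMatrix A).PosSemidef) {d : ℝ} (hd1 : d ≤ 1)
    (hd : d ≤ (1 - (stdMatrix A)ᵀ * stdMatrix A).det) : supNorm A ^ 2 ≤ 1 - d := by
  have h0 : 0 ≤ 1 - d := by linarith
  have : supNorm A ≤ √(1 - d) := by
    refine supNorm_le (Real.sqrt_nonneg _) fun v => ?_
    refine abs_le_of_sq_le_sq' ?_ (by positivity) |>.2
    rw [mul_pow, Real.sq_sqrt h0]
    have h1 := det_le_quadratic hpos (fun w => by
      rw [stdMatrix_quadratic]; have := sq_nonneg ‖A (WithLp.toLp 2 w)‖; linarith) (WithLp.ofLp v)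
    rw [stdMatrix_quadratic, dotProduct_self_eq_norm_sq] at h1
    have h2 := mul_le_mul_of_nonneg_right hd (sq_nonneg ‖v‖)
    simp only [WithLp.toLp_ofLp] at h1
    linarith
  calc supNorm A ^ 2 ≤ √(1 - d) ^ 2 := pow_le_pow_left₀ (supNorm_nonneg A) this 2
    _ = 1 - d := Real.sq_sqrt h0

lemma inducedMetric_eq_stdMatrix (u : E m → E n) (x : E m) :
    inducedMetric u x = 1 - (stdMatrix (fderiv ℝ u x))ᵀ * stdMatrix (fderiv ℝ u x) := rfl

end SupNorm

/-! ### Barriers and supporting hyperplanes. -/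

section Comparison

variable {m n : ℕ} {Ω : Set (E m)}

lemma fderiv_fderiv_add {f g : E m → ℝ} {x : E m} (hf : ContDiffAt ℝ 2 f x)
    (hg : ContDiffAt ℝ 2 g x) : fderiv ℝ (fderiv ℝ fun y => f y + g y) x =
      fderiv ℝ (fderiv ℝ f) x + fderiv ℝ (fderiv ℝ g) x := by
  have h1 : fderiv ℝ (fun y => f y + g y) =ᶠ[𝓝 x] fun y => fderiv ℝ f y + fderiv ℝ g y := by
    filter_upwards [hf.eventually (by simp), hg.eventually (by simp)] with y h1 h2
    exact fderiv_fun_add (h1.differentiableAt (by simp)) (h2.differentiableAt (by simp))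
  rw [h1.fderiv_eq]
  exact fderiv_fun_add
    ((hf.fderiv_right (m := 1) (by norm_num)).differentiableAt (by simp))
    ((hg.fderiv_right (m := 1) (by norm_num)).differentiableAt (by simp))

lemma fderiv_fderiv_barrier (L : E m →L[ℝ] ℝ) (p x : E m) (a b : ℝ) (v w : E m) :
    fderiv ℝ (fderiv ℝ fun y => a * L (y - p) - b / 2 * L (y - p) ^ 2) x v w =
      -b * (L v * L w) := by
  have hL : ∀ y, HasFDerivAt (fun y => L (y - p)) L y := fun y =>
    L.hasFDerivAt.comp y ((hasFDerivAt_id y).sub_const p)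
  have h1 : (fderiv ℝ fun y => a * L (y - p) - b / 2 * L (y - p) ^ 2) =
      fun y => (a - b * L (y - p)) • L := by
    funext y
    refine HasFDerivAt.fderiv ((((hL y).const_mul a).sub
      (((hL y).pow 2).const_mul (b / 2))).congr_fderiv ?_)
    ext z
    simp
    ring
  rw [h1]
  have h2 : HasFDerivAt (fun y => (a - b * L (y - p)) • L) ((-(b • L)).smulRight L) x := by
    exact (((hL x).const_mul b).const_sub a).smul_const L
  rw [h2.fderiv]
  simp
  ring

/-- Comparison with a quadratic barrier built on a supporting hyperplane. -/
lemma barrier_comparison (hΩ : IsOpen Ω) (hbdd : Bornology.IsBounded Ω) {w : E m → ℝ}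
    (hwc : ContinuousOn w (closure Ω)) (hw2 : ContDiffOn ℝ 2 w Ω)
    (hw0 : ∀ x ∈ frontier Ω, w x = 0) {P : E m → Matrix (Fin m) (Fin m) ℝ}
    (hP : ∀ x ∈ Ω, (P x).PosSemidef) (hP1 : ∀ x ∈ Ω, ∀ v : Fin m → ℝ, v ⬝ᵥ v ≤ v ⬝ᵥ P x *ᵥ v)
    {b' b : ℝ} (hb0 : 0 ≤ b) (hb : b' < b)
    (hLw : ∀ x ∈ Ω, ∑ l, ∑ k, P x l k • fderiv ℝ (fderiv ℝ w) x (stdVec l) (stdVec k) ≤ b')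
    {p ν : E m} (hp : p ∈ closure Ω) (hν : ‖ν‖ = 1) (hsupp : ∀ x ∈ closure Ω, 0 ≤ inner ℝ ν (x - p))
    {x : E m} (hx : x ∈ closure Ω) : -(b * diam Ω * inner ℝ ν (x - p)) ≤ w x := by
  set L : E m →L[ℝ] ℝ := innerSL ℝ ν with hL
  have hLapp : ∀ y, L y = inner ℝ ν y := fun y => rfl
  -- With `s = L (y - p) ∈ [0, diam Ω]`, `q = b s (diam Ω - s/2) ≥ 0`, and its Hessian contracted
  -- with `P ≥ 1` is at most `-b`. An interior minimum of `w + q` would force `0 ≤ b' - b < 0`.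
  set q : E m → ℝ := fun y => b * diam Ω * L (y - p) - b / 2 * L (y - p) ^ 2 with hq
  have hqc : ContDiff ℝ 2 q := by
    have : ContDiff ℝ 2 fun y => L (y - p) := L.contDiff.comp (contDiff_id.sub contDiff_const)
    exact (contDiff_const.mul this).sub (contDiff_const.mul (this.pow 2))
  have hcomp : IsCompact (closure Ω) := hbdd.isCompact_closure
  obtain ⟨z, hz, hzmin⟩ := hcomp.exists_isMinOn ⟨x, hx⟩ (hwc.add hqc.continuous.continuousOn)
  have hznonneg : 0 ≤ w z + q z := by
    by_cases hzΩ : z ∈ Ω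
    · exfalso
      have hw := hw2.contDiffAt (hΩ.mem_nhds hzΩ)
      have hloc : IsLocalMin (fun y => w y + q y) z := by
        filter_upwards [hΩ.mem_nhds hzΩ] with y hy using hzmin (subset_closure hy)
      have h1 := contracted_hessian_nonneg_of_isLocalMin (hw.add hqc.contDiffAt) hloc (hP z hzΩ)
      rw [show fderiv ℝ (fderiv ℝ fun y => w y + q y) z = _ from
        fderiv_fderiv_add hw hqc.contDiffAt] at h1
      simp only [add_apply, smul_add, Finset.sum_add_distrib] at h1
      have h2 : ∑ l, ∑ k, P z l k • fderiv ℝ (fderiv ℝ q) z (stdVec l) (stdVec k) =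
          -b * ((WithLp.ofLp ν) ⬝ᵥ P z *ᵥ (WithLp.ofLp ν)) := by
        simp only [hq, fderiv_fderiv_barrier, Matrix.mulVec, dotProduct, Finset.mul_sum]
        refine Finset.sum_congr rfl fun l _ => Finset.sum_congr rfl fun k _ => ?_
        have hs : ∀ i, L (stdVec i) = ν i := fun i => by
          rw [hLapp, stdVec, EuclideanSpace.inner_single_right]
          simp
        rw [hs, hs, smul_eq_mul]; ring
      have h3 := hP1 z hzΩ (WithLp.ofLp ν)
      rw [dotProduct_self_eq_norm_sq, hν] at h3
      have h4 := hLw z hzΩ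
      rw [h2] at h1
      nlinarith
    · have hzf : z ∈ frontier Ω := by
        rw [hΩ.frontier_eq]; exact ⟨hz, hzΩ⟩
      have hd0 : 0 ≤ L (z - p) := hsupp z hz
      have hd1 : L (z - p) ≤ diam Ω := by
        calc L (z - p) ≤ ‖ν‖ * ‖z - p‖ := real_inner_le_norm ν (z - p)
          _ = dist z p := by rw [hν, one_mul, dist_eq_norm]
          _ ≤ diam (closure Ω) := dist_le_diam_of_mem hbdd.closure hz hp
          _ = diam Ω := Metric.diam_closure Ω
      rw [hw0 z hzf, zero_add]
      have : q z = b * L (z - p) * (diam Ω - L (z - p) / 2) := by simp only [hq]; ring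
      rw [this]
      exact mul_nonneg (mul_nonneg hb0 hd0) (by linarith)
  have h5 : w z + q z ≤ w x + q x := hzmin hx
  have h6 : q x ≤ b * diam Ω * inner ℝ ν (x - p) := by
    simp only [hq, hLapp]
    have : 0 ≤ b / 2 * inner ℝ ν (x - p) ^ 2 := by positivity
    linarith
  linarith

lemma exists_support_normal (hΩ : IsOpen Ω) (hne : Ω.Nonempty) (hconv : Convex ℝ Ω) {p : E m}
    (hp : p ∈ frontier Ω) : ∃ ν : E m, ‖ν‖ = 1 ∧ ∀ x ∈ closure Ω, 0 ≤ inner ℝ ν (x - p) := by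
  have hp' : p ∉ Ω := by rw [hΩ.frontier_eq] at hp; exact hp.2
  obtain ⟨f, hf⟩ := geometric_hahn_banach_open_point hconv hΩ hp'
  set ν₀ : E m := (InnerProductSpace.toDual ℝ (E m)).symm f with hν₀
  have happ : ∀ x, inner ℝ ν₀ x = f x := fun x => InnerProductSpace.toDual_symm_apply
  have hν₀0 : ν₀ ≠ 0 := by
    intro h0
    obtain ⟨a, ha⟩ := hne
    have h1 := hf a ha
    rw [← happ, ← happ, h0] at h1
    simp at h1
  have hpos : 0 < ‖ν₀‖ := norm_pos_iff.2 hν₀0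
  refine ⟨-(‖ν₀‖⁻¹ • ν₀), by simp [norm_smul, hpos.ne'], ?_⟩
  have hcl : IsClosed {x : E m | 0 ≤ inner ℝ (-(‖ν₀‖⁻¹ • ν₀)) (x - p)} :=
    isClosed_le continuous_const (by fun_prop)
  refine fun x hx => closure_minimal (fun y hy => ?_) hcl hx
  have := hf y hy
  simp only [mem_ofPred_eq, inner_neg_left, inner_smul_left, inner_sub_right, happ]
  have h2 : 0 ≤ ‖ν₀‖⁻¹ := by positivity
  simp only [conj_trivial]
  nlinarith

/-- Take `ℓ = Dρ(p)`: since `ρ p ≤ 0`, moving in a direction of strict decrease enters `{ρ < 0}`.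
Boundary regularity is used only here, to supply enough inward directions to determine a derivative
at `p`. -/
lemma exists_inward_halfspace (hΩ : IsOpen Ω) (hC2 : HasC2Boundary Ω) {p : E m}
    (hp : p ∈ frontier Ω) : ∃ ℓ : E m →L[ℝ] ℝ, ℓ ≠ 0 ∧
      ∀ v, ℓ v < 0 → ∀ᶠ t in 𝓝[>] (0 : ℝ), p + t • v ∈ Ω := by
  obtain ⟨U, ρ, hU, hpU, hρ, hρ', hΩU⟩ := hC2 p hp
  have hpΩ : p ∈ closure Ω ∧ p ∉ Ω := by rwa [hΩ.frontier_eq] at hp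
  have hd : DifferentiableAt ℝ ρ p := (hρ.contDiffAt (hU.mem_nhds hpU)).differentiableAt (by simp)
  have hle : ρ p ≤ 0 := by
    have hmem : p ∈ closure (Ω ∩ U) := by
      rw [inter_comm]; exact hU.inter_closure ⟨hpU, hpΩ.1⟩
    by_contra! hlt
    obtain ⟨y, hy1, hy2⟩ := mem_closure_iff_nhds.1 hmem _ (hd.continuousAt.eventually (lt_mem_nhds hlt))
    rw [hΩU] at hy2
    exact lt_asymm hy1 hy2.2
  refine ⟨fderiv ℝ ρ p, hρ' p hpU, fun v hv => ?_⟩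
  have h0 : DifferentiableAt ℝ ρ (p + (0 : ℝ) • v) := by simpa using hd
  have h1 := (hasDerivAt_comp_line h0).hasDerivWithinAt (s := Ioi 0)
  have hv' : fderiv ℝ ρ (p + (0 : ℝ) • v) v < 0 := by simpa using hv
  have h2 := h1.limsup_slope_le' (by simp) hv'
  have hline : Continuous fun t : ℝ => p + t • v := by fun_prop
  have h3 : ∀ᶠ t in 𝓝[>] (0 : ℝ), p + t • v ∈ U :=
    nhdsWithin_le_nhds (hline.continuousAt.eventually (by simpa using hU.mem_nhds hpU))
  filter_upwards [h2, h3, self_mem_nhdsWithin] with t ht htU htpos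
  have htpos : 0 < t := htpos
  have : p + t • v ∈ Ω ∩ U := by
    rw [hΩU]
    refine ⟨htU, ?_⟩
    simp only [slope_def_field, sub_zero, zero_smul, add_zero] at ht
    rw [div_lt_iff₀ htpos] at ht
    linarith
  exact this.1

/-- A map that vanishes linearly in the distance to a supporting hyperplane has a derivative
bounded by the same constant. -/
lemma norm_fderiv_le_of_barrier (hΩ : IsOpen Ω) (hC2 : HasC2Boundary Ω) {p : E m}
    (hp : p ∈ frontier Ω) {w : E m → E n} {A : E m →L[ℝ] E n}
    (hA : HasFDerivWithinAt w A (closure Ω) p) (hwp : w p = 0) {c : ℝ} (hc : 0 ≤ c) {ν : E m}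
    (hν : ‖ν‖ = 1) (hw : ∀ x ∈ closure Ω, ‖w x‖ ≤ c * inner ℝ ν (x - p)) (v : E m) :
    ‖A v‖ ≤ c * ‖v‖ := by
  obtain ⟨ℓ, hℓ0, hℓ⟩ := exists_inward_halfspace hΩ hC2 hp
  -- One-sided difference quotients along inward directions. Replacing `v` by `-v` covers the
  -- opposite half-space, and `v + s • v₀` with `s → 0⁺` covers the kernel of `ℓ`.
  have hneg : ∀ v, ℓ v < 0 → ‖A v‖ ≤ c * ‖v‖ := fun v hv => by
    have hin := hℓ v hv
    have hlim := hA.lim (l := 𝓝[>] (0 : ℝ)) (c := fun t => t⁻¹) (d := fun t => t • v) (v := v)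
      (by
        have h : Continuous fun t : ℝ => t • v := by fun_prop
        simpa using (h.tendsto 0).mono_left (nhdsWithin_le_nhds (s := Ioi 0)))
      (by filter_upwards [hin] with t ht using subset_closure ht)
      (by
        refine tendsto_const_nhds.congr' ?_
        filter_upwards [self_mem_nhdsWithin] with t ht
        rw [smul_smul, inv_mul_cancel₀ (ne_of_gt ht), one_smul])
    refine le_of_tendsto hlim.norm ?_
    filter_upwards [hin, self_mem_nhdsWithin] with t ht htpos
    have htpos : 0 < t := htpos
    have h1 := hw _ (subset_closure ht)
    rw [add_sub_cancel_left, inner_smul_right] at h1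
    rw [hwp, sub_zero, norm_smul, norm_inv, Real.norm_of_nonneg htpos.le, inv_mul_le_iff₀ htpos]
    have h2 : inner ℝ ν v ≤ ‖v‖ := by simpa [hν] using real_inner_le_norm ν v
    calc _ ≤ c * (t * inner ℝ ν v) := h1
      _ ≤ c * (t * ‖v‖) := by gcongr
      _ = _ := by ring
  have hne : ∀ v, ℓ v ≠ 0 → ‖A v‖ ≤ c * ‖v‖ := fun v hv => by
    rcases lt_or_gt_of_ne hv with h | h
    · exact hneg v h
    · simpa using hneg (-v) (by simpa using h)
  by_cases hv : ℓ v = 0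
  · obtain ⟨v₀, hv₀⟩ : ∃ v₀, ℓ v₀ ≠ 0 := by
      by_contra! h
      exact hℓ0 (ContinuousLinearMap.ext h)
    have hc1 : Continuous fun s : ℝ => ‖A (v + s • v₀)‖ := by fun_prop
    have hc2 : Continuous fun s : ℝ => c * ‖v + s • v₀‖ := by fun_prop
    have t1 := (hc1.tendsto 0).mono_left (nhdsWithin_le_nhds (s := Ioi 0))
    have t2 := (hc2.tendsto 0).mono_left (nhdsWithin_le_nhds (s := Ioi 0))
    simp only [zero_smul, add_zero] at t1 t2
    refine le_of_tendsto_of_tendsto t1 t2 ?_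
    filter_upwards [self_mem_nhdsWithin] with s hs
    refine hne _ ?_
    have hs : s ≠ 0 := ne_of_gt hs
    simp [hv, hs, hv₀]
  · exact hne v hv

end Comparison

/-! ### The boundary gradient estimate. -/

section BoundaryGradient

variable {m n : ℕ} {Ω : Set (E m)}

lemma fderiv_fderiv_clm_comp {f : E m → E n} {x : E m} (hf : ContDiffAt ℝ 2 f x)
    (T : E n →L[ℝ] ℝ) (v w : E m) :
    fderiv ℝ (fderiv ℝ fun y => T (f y)) x v w = T (fderiv ℝ (fderiv ℝ f) x v w) := by
  have hd1 : DifferentiableAt ℝ (fderiv ℝ f) x :=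
    (hf.fderiv_right (m := 1) (by norm_num)).differentiableAt (by simp)
  have hTf : ContDiffAt ℝ 2 (fun y => T (f y)) x := T.contDiff.contDiffAt.comp x hf
  have h1 : (fun y => fderiv ℝ (fun y => T (f y)) y w) =ᶠ[𝓝 x] fun y => T (fderiv ℝ f y w) := by
    filter_upwards [hf.eventually (by simp)] with y hy
    exact congrArg (fun A => A w)
      (T.hasFDerivAt.comp y (hy.differentiableAt (by simp)).hasFDerivAt).fderiv
  rw [← fderiv_fderiv_apply hTf, h1.fderiv_eq]
  have h2 := T.hasFDerivAt.comp x (hd1.clm_apply (differentiableAt_const w)).hasFDerivAt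
  refine (congrArg (fun A => A v) h2.fderiv).trans ?_
  rw [fderiv_clm_apply hd1 (differentiableAt_const w)]
  simp

/-- If `P = BᵀB`, the squared lengths of the rows of `B` add up to `tr P`, so the diagonal bounds
sum with no loss from polarization. -/
lemma norm_contraction_le {P : Matrix (Fin m) (Fin m) ℝ} (hP : P.PosSemidef) {M : ℝ}
    {β : E m →L[ℝ] E m →L[ℝ] E n} (hβ : ∀ v, ‖β v v‖ ≤ M * ‖v‖ ^ 2) :
    ‖∑ l, ∑ k, P l k • β (stdVec l) (stdVec k)‖ ≤ M * P.trace := by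
  obtain ⟨B, hB⟩ := exists_transpose_mul_self hP
  rw [sum_gram_bilinear hB]
  have ht : P.trace = ∑ s, ‖(WithLp.toLp 2 (B s) : E m)‖ ^ 2 := by
    simp only [EuclideanSpace.real_norm_sq_eq, hB, Matrix.trace, Matrix.diag, Matrix.mul_apply,
      Matrix.transpose_apply, ← pow_two]
    exact Finset.sum_comm
  rw [ht, Finset.mul_sum]
  exact norm_sum_le_of_le _ fun s _ => hβ _

variable {φ u : E m → E n}

lemma maximalOperator_eq_sum (x : E m) : maximalOperator u x =
    ∑ l, ∑ k, (inducedMetric u x)⁻¹ l k • fderiv ℝ (fderiv ℝ u) x (stdVec l) (stdVec k) := by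
  simp [maximalOperator, iteratedFDeriv_two_apply]

/-- A solution stays within linear distance of its boundary data, as measured from a supporting
hyperplane. -/
lemma norm_sub_le_of_support (hΩ : IsOpen Ω) (hbdd : Bornology.IsBounded Ω)
    (hφ : ContDiffOn ℝ 2 φ (closure Ω)) (hu : IsSmoothSolution Ω φ u) {κ : ℝ} (hκ : 0 < κ)
    (hg : ∀ x ∈ Ω, ∀ v : Fin m → ℝ, κ * (v ⬝ᵥ v) ≤ v ⬝ᵥ inducedMetric u x *ᵥ v) {M b : ℝ}
    (hM0 : 0 ≤ M) (hM : ∀ x ∈ Ω, ∀ v, ‖fderiv ℝ (fderiv ℝ φ) x v v‖ ≤ M * ‖v‖ ^ 2)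
    (hb : M * (m / κ) < b) {p ν : E m} (hp : p ∈ closure Ω) (hν : ‖ν‖ = 1)
    (hsupp : ∀ x ∈ closure Ω, 0 ≤ inner ℝ ν (x - p)) {x : E m} (hx : x ∈ closure Ω) :
    ‖u x - φ x‖ ≤ b * diam Ω * inner ℝ ν (x - p) := by
  have hb0 : 0 ≤ b := le_trans (by positivity) hb.le
  have hrhs : 0 ≤ b * diam Ω * inner ℝ ν (x - p) :=
    mul_nonneg (mul_nonneg hb0 diam_nonneg) (hsupp x hx)
  by_cases hz : u x - φ x = 0
  · rw [hz, norm_zero]; exact hrhs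
  have hz' : 0 < ‖u x - φ x‖ := norm_pos_iff.2 hz
  -- Projecting on this unit vector, chosen for the given `x`, gives a scalar function equal to `-‖u
  -- x - φ x‖` at `x`, so the scalar barrier bounds the full vector.
  set e : E n := -(‖u x - φ x‖⁻¹ • (u x - φ x)) with he
  have hen : ‖e‖ = 1 := by rw [he, norm_neg, norm_smul, norm_inv, norm_norm, inv_mul_cancel₀ hz'.ne']
  set T : E n →L[ℝ] ℝ := innerSL ℝ e with hT
  have hTle : ∀ y, |T y| ≤ ‖y‖ := fun y => by
    have := abs_real_inner_le_norm e y
    rwa [hen, one_mul] at this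
  have huC := hu.contDiffOn_closure.continuousOn
  have hφC := hφ.continuousOn
  have hu2 : ContDiffOn ℝ 2 u Ω := hu.smooth.of_le (WithTop.coe_le_coe.2 le_top)
  have hφ2 : ContDiffOn ℝ 2 φ Ω := hφ.mono subset_closure
  have hpd : ∀ y ∈ Ω, (inducedMetric u y).PosDef := fun y hy => posDef_one_sub hκ (hg y hy)
  have key := barrier_comparison (w := fun y => T (u y) + (-T) (φ y)) hΩ hbdd
    ((T.continuous.comp_continuousOn huC).add ((-T).continuous.comp_continuousOn hφC))
    ((T.contDiff.comp_contDiffOn hu2).add ((-T).contDiff.comp_contDiffOn hφ2))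
    (fun y hy => by simp [hu.boundary y hy])
    (P := fun y => (inducedMetric u y)⁻¹) (fun y hy => (hpd y hy).inv.posSemidef)
    (fun y hy v => inv_sub_one_posSemidef (hpd y hy) v) hb0 hb ?_ hp hν hsupp hx
  · have h1 : T (u x) + (-T) (φ x) = -‖u x - φ x‖ := by
      have : T (u x) + (-T) (φ x) = T (u x - φ x) := by simp [sub_eq_add_neg]
      rw [this, hT, innerSL_apply_apply, he, inner_neg_left, real_inner_smul_left,
        real_inner_self_eq_norm_sq]
      field_simp
    rw [h1] at key
    linarith
  · intro y hy
    have hfu := hu2.contDiffAt (hΩ.mem_nhds hy)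
    have hfφ := hφ2.contDiffAt (hΩ.mem_nhds hy)
    have hTu : ContDiffAt ℝ 2 (fun y => T (u y)) y := T.contDiff.contDiffAt.comp y hfu
    have hTφ : ContDiffAt ℝ 2 (fun y => (-T) (φ y)) y := (-T).contDiff.contDiffAt.comp y hfφ
    rw [fderiv_fderiv_add hTu hTφ]
    simp only [add_apply, fderiv_fderiv_clm_comp hfu, fderiv_fderiv_clm_comp hfφ,
      smul_add, Finset.sum_add_distrib]
    have hS : ∀ (S : E n →L[ℝ] ℝ) (β : E m →L[ℝ] E m →L[ℝ] E n),
        ∑ l, ∑ k, (inducedMetric u y)⁻¹ l k • S (β (stdVec l) (stdVec k)) =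
          S (∑ l, ∑ k, (inducedMetric u y)⁻¹ l k • β (stdVec l) (stdVec k)) := fun S β => by
      simp only [map_sum, map_smul]
    -- The operator annihilates `u`; only the Hessian of `φ` remains, contributing at most `M tr g⁻¹
    -- ≤ M m/κ`.
    rw [hS, hS, ← maximalOperator_eq_sum, hu.maximal y hy, map_zero, zero_add, neg_apply]
    have h1 := norm_contraction_le (hpd y hy).inv.posSemidef (hM y hy)
    have h2 := inv_trace_le hκ (hg y hy)
    refine (neg_le_abs _).trans ((hTle _).trans (h1.trans ?_))
    exact mul_le_mul_of_nonneg_left h2 hM0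

/-- The barrier bounds `D(u - φ)` at `p`, and the triangle inequality adds `Dφ`. -/
lemma boundary_gradient_le (hΩ : IsOpen Ω) (hne : Ω.Nonempty) (hbdd : Bornology.IsBounded Ω)
    (hconv : Convex ℝ Ω) (hC2 : HasC2Boundary Ω)
    (hφ : ContDiffOn ℝ 2 φ (closure Ω)) (hu : IsSmoothSolution Ω φ u) {κ : ℝ} (hκ : 0 < κ)
    (hg : ∀ x ∈ Ω, ∀ v : Fin m → ℝ, κ * (v ⬝ᵥ v) ≤ v ⬝ᵥ inducedMetric u x *ᵥ v) {M b : ℝ}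
    (hM0 : 0 ≤ M) (hM : ∀ x ∈ Ω, ∀ v, ‖fderiv ℝ (fderiv ℝ φ) x v v‖ ≤ M * ‖v‖ ^ 2)
    (hb : M * (m / κ) < b) {p : E m} (hp : p ∈ frontier Ω) (v : E m) :
    ‖fderivWithin ℝ u (closure Ω) p v‖ ≤
      (b * diam Ω + supNorm (fderivWithin ℝ φ (closure Ω) p)) * ‖v‖ := by
  have hpc : p ∈ closure Ω := frontier_subset_closure hp
  obtain ⟨ν, hν, hsupp⟩ := exists_support_normal hΩ hne hconv hp
  have hdu := (hu.contDiffOn_closure.differentiableOn (by simp) p hpc).hasFDerivWithinAt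
  have hdφ := (hφ.differentiableOn (by simp) p hpc).hasFDerivWithinAt
  have hb0 : 0 ≤ b := le_trans (by positivity) hb.le
  have h1 := norm_fderiv_le_of_barrier hΩ hC2 hp (hdu.sub hdφ) (by simp [hu.boundary p hp])
    (mul_nonneg hb0 diam_nonneg) hν
    (fun x hx => norm_sub_le_of_support hΩ hbdd hφ hu hκ hg hM0 hM hb hpc hν hsupp hx) v
  have h2 := norm_apply_le_supNorm (fderivWithin ℝ φ (closure Ω) p) v
  rw [sub_apply] at h1
  have h3 := norm_le_norm_sub_add (fderivWithin ℝ u (closure Ω) p v)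
    (fderivWithin ℝ φ (closure Ω) p v)
  linarith

end BoundaryGradient

/-! ### The minimum principle for `det g`. -/

section MinimumPrinciple

variable {m n : ℕ} {Ω : Set (E m)} {u : E m → E n}

lemma contDiff_const_mul_norm_sq (a : ℝ) : ContDiff ℝ 2 fun y : E m => a * ‖y‖ ^ 2 :=
  contDiff_const.mul (contDiff_norm_sq ℝ)

lemma fderiv_fderiv_const_mul_norm_sq (a : ℝ) (x v w : E m) :
    fderiv ℝ (fderiv ℝ fun y : E m => a * ‖y‖ ^ 2) x v w = 2 * a * inner ℝ v w := by
  rw [← fderiv_fderiv_apply (contDiff_const_mul_norm_sq a).contDiffAt]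
  have h1 : (fun y => fderiv ℝ (fun y : E m => a * ‖y‖ ^ 2) y w) =
      fun y => ((2 * a) • innerSL ℝ w) y := by
    funext y
    rw [(((hasStrictFDerivAt_norm_sq y).hasFDerivAt).const_mul a).fderiv]
    simp [real_inner_comm]
    ring
  rw [h1, ContinuousLinearMap.fderiv]
  simp [real_inner_comm]

/-- Minimum principle for `det g` on a maximal graph. -/
lemma le_det_of_le_on_frontier (hm : 0 < m) (hΩ : IsOpen Ω) (hbdd : Bornology.IsBounded Ω)
    (hu : ContDiffOn ℝ ∞ u Ω) (hmax : ∀ x ∈ Ω, maximalOperator u x = 0)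
    (hpos : ∀ x ∈ Ω, (inducedMetric u x).PosDef) {G : E m → ℝ}
    (hGc : ContinuousOn G (closure Ω)) (hG : ∀ x ∈ Ω, G x = (inducedMetric u x).det) {c : ℝ}
    (hc : 0 < c) (hGf : ∀ x ∈ frontier Ω, c ≤ G x) {x : E m} (hx : x ∈ Ω) : c ≤ G x := by
  have hGpos : ∀ y ∈ closure Ω, 0 < G y := fun y hy => by
    by_cases hyΩ : y ∈ Ω
    · rw [hG y hyΩ]; exact (hpos y hyΩ).det_pos
    · exact hc.trans_le (hGf y (by rw [hΩ.frontier_eq]; exact ⟨hy, hyΩ⟩))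
  obtain ⟨R, hR⟩ := hbdd.closure.exists_norm_le
  have hlogc : ContinuousOn (fun y => Real.log (G y)) (closure Ω) :=
    hGc.log fun y hy => (hGpos y hy).ne'
  -- Subtracting `ε‖y‖²` makes the supersolution strict: the contracted Hessian drops by `2ε tr g⁻¹
  -- > 0`, which excludes an interior minimum. The trace is positive because `m > 0`.
  have hε : ∀ ε > 0, Real.log c ≤ Real.log (G x) + ε * R ^ 2 := fun ε hε => by
    obtain ⟨z, hz, hzmin⟩ := hbdd.isCompact_closure.exists_isMinOn ⟨x, subset_closure hx⟩
      (hlogc.add (contDiff_const_mul_norm_sq (-ε)).continuous.continuousOn)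
    have hzx : Real.log (G z) + -ε * ‖z‖ ^ 2 ≤ Real.log (G x) + -ε * ‖x‖ ^ 2 :=
      hzmin (subset_closure hx)
    have hzf : z ∈ frontier Ω := by
      rw [hΩ.frontier_eq]
      refine ⟨hz, fun hzΩ => ?_⟩
      have hlog : ContDiffAt ℝ 2 (fun y => Real.log (inducedMetric u y).det) z :=
        contDiffAt_two_of_smooth hΩ ((smoothEntries_inducedMetric hΩ hu).det.log
          fun y hy => (hpos y hy).det_pos.ne') hzΩ
      have hloc : IsLocalMin
          (fun y => Real.log (inducedMetric u y).det + -ε * ‖y‖ ^ 2) z := by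
        filter_upwards [hΩ.mem_nhds hzΩ] with y hy
        rw [← hG y hy, ← hG z hzΩ]
        exact hzmin (subset_closure hy)
      have hP := (hpos z hzΩ).inv
      have h1 := contracted_hessian_nonneg_of_isLocalMin
        (hlog.add (contDiff_const_mul_norm_sq (-ε)).contDiffAt) hloc hP.posSemidef
      rw [show fderiv ℝ (fderiv ℝ fun y => Real.log (inducedMetric u y).det + -ε * ‖y‖ ^ 2) z = _
        from fderiv_fderiv_add hlog (contDiff_const_mul_norm_sq (-ε)).contDiffAt] at h1
      simp only [add_apply, smul_add, Finset.sum_add_distrib, fderiv_fderiv_const_mul_norm_sq] at h1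
      have h2 := contracted_hessian_log_det_nonpos hΩ hu hmax hpos hzΩ
      have h3 : ∑ l, ∑ k, (inducedMetric u z)⁻¹ l k •
          (2 * -ε * inner ℝ (stdVec l : E m) (stdVec k)) = -(2 * ε) * (inducedMetric u z)⁻¹.trace := by
        simp only [stdVec, EuclideanSpace.inner_single_left, Matrix.trace, Matrix.diag,
          Finset.mul_sum]
        refine Finset.sum_congr rfl fun l _ => ?_
        simp
        ring
      have : Nonempty (Fin m) := ⟨⟨0, hm⟩⟩
      have h4 := hP.trace_pos
      rw [h3] at h1
      nlinarith
    have h1 : Real.log c ≤ Real.log (G z) := Real.log_le_log hc (hGf z hzf)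
    have h2 : ‖z‖ ^ 2 ≤ R ^ 2 := pow_le_pow_left₀ (norm_nonneg _) (hR z hz) 2
    have h3 := sq_nonneg ‖x‖
    nlinarith
  have hfin : Real.log c ≤ Real.log (G x) := by
    refine le_of_forall_pos_le_add fun η hη => ?_
    have hR1 : 0 < R ^ 2 + 1 := by positivity
    refine (hε (η / (R ^ 2 + 1)) (by positivity)).trans ?_
    have : η / (R ^ 2 + 1) * R ^ 2 ≤ η := by
      rw [div_mul_eq_mul_div, div_le_iff₀ hR1]
      nlinarith
    linarith
  exact (Real.log_le_log_iff hc (hGpos x (subset_closure hx))).1 hfin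

end MinimumPrinciple

/-! ### Suprema of the data and the final estimate. -/

section Assembly

variable {m n : ℕ} {Ω : Set (E m)} {φ u : E m → E n}

lemma uniqueDiffOn_closure (hΩ : IsOpen Ω) (hne : Ω.Nonempty) (hconv : Convex ℝ Ω) :
    UniqueDiffOn ℝ (closure Ω) :=
  uniqueDiffOn_convex hconv.closure (hne.mono (interior_maximal subset_closure hΩ))

/-- A real `sSup` of an unbounded set is `0`, so boundedness must be shown: the second derivative
within the compact closure is continuous and agrees with the ordinary one in `Ω`. -/
lemma norm_second_fderiv_le (hΩ : IsOpen Ω) (hne : Ω.Nonempty) (hbdd : Bornology.IsBounded Ω)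
    (hconv : Convex ℝ Ω) (hφ : ContDiffOn ℝ 2 φ (closure Ω)) {x : E m} (hx : x ∈ Ω) (v : E m) :
    ‖fderiv ℝ (fderiv ℝ φ) x v v‖ ≤
      sSup ((fun x => supNorm₂ (iteratedFDeriv ℝ 2 φ x)) '' Ω) * ‖v‖ ^ 2 := by
  have hud := uniqueDiffOn_closure hΩ hne hconv
  obtain ⟨C, hC⟩ := hbdd.isCompact_closure.exists_bound_of_continuousOn
    (hφ.continuousOn_iteratedFDerivWithin (m := 2) le_rfl hud)
  have hB : BddAbove ((fun x => supNorm₂ (iteratedFDeriv ℝ 2 φ x)) '' Ω) := by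
    refine ⟨C, ?_⟩
    rintro _ ⟨y, hy, rfl⟩
    have h1 := hC y (subset_closure hy)
    rw [iteratedFDerivWithin_eq_iteratedFDeriv hud
      ((hφ.mono subset_closure).contDiffAt (hΩ.mem_nhds hy)) (subset_closure hy)] at h1
    exact Real.sSup_le (fun z hz => (supNorm₂_bddAbove _ z hz).trans h1)
      ((norm_nonneg _).trans h1)
  have h2 := norm_apply_le_supNorm₂ (iteratedFDeriv ℝ 2 φ x) v
  rw [iteratedFDeriv_two_apply] at h2
  exact h2.trans (mul_le_mul_of_nonneg_right (le_csSup hB ⟨x, hx, rfl⟩) (sq_nonneg _))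

lemma supNorm_fderivWithin_le (hΩ : IsOpen Ω) (hne : Ω.Nonempty) (hbdd : Bornology.IsBounded Ω)
    (hconv : Convex ℝ Ω) (hφ : ContDiffOn ℝ 2 φ (closure Ω)) {p : E m} (hp : p ∈ frontier Ω) :
    supNorm (fderivWithin ℝ φ (closure Ω) p) ≤
      sSup ((fun x => supNorm (fderivWithin ℝ φ (closure Ω) x)) '' frontier Ω) := by
  have hud := uniqueDiffOn_closure hΩ hne hconv
  obtain ⟨C, hC⟩ := hbdd.isCompact_closure.exists_bound_of_continuousOn
    (hφ.continuousOn_fderivWithin hud (by simp))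
  refine le_csSup ⟨C, ?_⟩ ⟨p, hp, rfl⟩
  rintro _ ⟨y, hy, rfl⟩
  have h1 := hC y (frontier_subset_closure hy)
  exact supNorm_le ((norm_nonneg _).trans h1) fun v =>
    (ContinuousLinearMap.le_opNorm _ v).trans (mul_le_mul_of_nonneg_right h1 (norm_nonneg v))

lemma fderivWithin_closure_eq (hΩ : IsOpen Ω) {x : E m} (hx : x ∈ Ω) :
    fderivWithin ℝ u (closure Ω) x = fderiv ℝ u x :=
  fderivWithin_of_mem_nhds (Filter.mem_of_superset (hΩ.mem_nhds hx) subset_closure)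

lemma continuousOn_det_stdMatrix (hΩ : IsOpen Ω) (hne : Ω.Nonempty) (hconv : Convex ℝ Ω)
    (hu : ContDiffOn ℝ 1 u (closure Ω)) :
    ContinuousOn (fun x => (1 - (stdMatrix (fderivWithin ℝ u (closure Ω) x))ᵀ *
      stdMatrix (fderivWithin ℝ u (closure Ω) x)).det) (closure Ω) := by
  have hd := hu.continuousOn_fderivWithin (uniqueDiffOn_closure hΩ hne hconv) le_rfl
  have hJ : ContinuousOn (fun x => stdMatrix (fderivWithin ℝ u (closure Ω) x)) (closure Ω) := by
    refine continuousOn_pi.2 fun γ => continuousOn_pi.2 fun i => ?_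
    exact (EuclideanSpace.proj (𝕜 := ℝ) γ).continuous.comp_continuousOn
      (hd.clm_apply continuousOn_const)
  have hdet : Continuous fun J : Matrix (Fin n) (Fin m) ℝ => (1 - Jᵀ * J).det := by fun_prop
  exact hdet.comp_continuousOn hJ

/-- The a priori gradient estimate: `|||Du|||² ≤ 1 - κ` improves to a strict inequality. -/
theorem sSup_supNorm_sq_lt (m n : ℕ) (hm : 2 ≤ m)
    (Ω : Set (E m)) (hΩ_open : IsOpen Ω) (hΩ_ne : Ω.Nonempty)
    (hΩ_bdd : Bornology.IsBounded Ω) (hΩ_conv : Convex ℝ Ω)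
    (hΩ_C2 : HasC2Boundary Ω)
    (φ : E m → E n) (hφ : ContDiffOn ℝ 2 φ (closure Ω))
    (κ : ℝ) (hκ0 : 0 < κ) (hκ1 : κ < 1)
    (hsmall :
      4 * (m : ℝ) * Metric.diam Ω / κ *
          sSup ((fun x => supNorm₂ (iteratedFDeriv ℝ 2 φ x)) '' Ω) +
        2 * sSup ((fun x => supNorm (fderivWithin ℝ φ (closure Ω) x)) ''
          frontier Ω) <
      Real.sqrt (1 - κ ^ (1 / (m : ℝ))))
    (u : E m → E n)
    (hu : IsSmoothSolution Ω φ u)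
    (hgrad : sSup ((fun x => supNorm (fderiv ℝ u x) ^ 2) '' Ω) ≤ 1 - κ) :
    sSup ((fun x => supNorm (fderiv ℝ u x) ^ 2) '' Ω) < 1 - κ := by
  set M := sSup ((fun x => supNorm₂ (iteratedFDeriv ℝ 2 φ x)) '' Ω) with hMdef
  set S := sSup ((fun x => supNorm (fderivWithin ℝ φ (closure Ω) x)) '' frontier Ω) with hSdef
  have hM0 : 0 ≤ M := Real.sSup_nonneg (by rintro _ ⟨x, _, rfl⟩; exact supNorm₂_nonneg _)
  have hS0 : 0 ≤ S := Real.sSup_nonneg (by rintro _ ⟨x, _, rfl⟩; exact supNorm_nonneg _)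
  have hδ : 0 ≤ diam Ω := diam_nonneg
  have hm0 : (0 : ℝ) < m := by exact_mod_cast (by omega : 0 < m)
  have hgx : ∀ x ∈ Ω, supNorm (fderiv ℝ u x) ^ 2 ≤ 1 - κ := fun x hx => by
    -- The spacelike condition bounds the set by `1`, so its `sSup` is a genuine supremum.
    refine (le_csSup ⟨1, ?_⟩ (mem_image_of_mem _ hx)).trans hgrad
    rintro _ ⟨y, hy, rfl⟩
    exact pow_le_one₀ (supNorm_nonneg _) (hu.spacelike y hy).le
  have hg : ∀ x ∈ Ω, ∀ v : Fin m → ℝ, κ * (v ⬝ᵥ v) ≤ v ⬝ᵥ inducedMetric u x *ᵥ v :=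
    fun x hx v => by
      have h1 := quadratic_ge_of_norm_le (norm_apply_le_supNorm (fderiv ℝ u x)) v
      have h2 := mul_le_mul_of_nonneg_right (hgx x hx) (dotProduct_self_nonneg' v)
      rw [inducedMetric_eq_stdMatrix]
      linarith
  have hpos : ∀ x ∈ Ω, (inducedMetric u x).PosDef := fun x hx => posDef_one_sub hκ0 (hg x hx)
  -- The barrier needs a strict inequality for `b`, so part of the slack in `hsmall` is spent;
  -- dividing by `diam Ω + 1` costs at most half of `gap`. The factors `4` and `2` exceed what is
  -- needed.
  obtain ⟨b, hb, hbS⟩ : ∃ b, M * (m / κ) < b ∧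
      b * diam Ω + S < Real.sqrt (1 - κ ^ (1 / (m : ℝ))) := by
    set gap := Real.sqrt (1 - κ ^ (1 / (m : ℝ))) - (M * (m / κ) * diam Ω + S) with hgap
    have hX : 0 ≤ M * (m / κ) * diam Ω := by positivity
    have hgap0 : 0 < gap := by
      have : 4 * (m : ℝ) * diam Ω / κ * M = 4 * (M * (m / κ) * diam Ω) := by ring
      rw [this] at hsmall
      linarith
    refine ⟨M * (m / κ) + gap / (2 * (diam Ω + 1)), by
      have : 0 < gap / (2 * (diam Ω + 1)) := by positivity
      linarith, ?_⟩
    have : gap / (2 * (diam Ω + 1)) * diam Ω ≤ gap / 2 := by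
      rw [div_mul_eq_mul_div, div_le_iff₀ (by positivity)]
      nlinarith
    linarith
  set c := b * diam Ω + S with hc
  have hb0 : 0 ≤ b := le_trans (by positivity) hb.le
  have hc0 : 0 ≤ c := by positivity
  have hκm : κ ^ (1 / (m : ℝ)) < 1 := Real.rpow_lt_one hκ0.le hκ1 (by positivity)
  have hc2 : κ ^ (1 / (m : ℝ)) < 1 - c ^ 2 := by
    have := (Real.lt_sqrt hc0).1 hbS
    linarith
  have hκm0 : 0 < κ ^ (1 / (m : ℝ)) := Real.rpow_pos_of_pos hκ0 _
  -- All eigenvalues of `g` on the boundary are at least `1 - c²`, so `d` bounds `det g` there; the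
  -- exponent `1/m` in the hypothesis is what gives `d > κ`.
  set d := (1 - c ^ 2) ^ m with hd
  have hκd : κ < d := by
    have h1 : (κ ^ (1 / (m : ℝ))) ^ m = κ := by
      rw [one_div, Real.rpow_inv_natCast_pow hκ0.le (by omega)]
    rw [← h1]
    exact pow_lt_pow_left₀ hc2 hκm0.le (by omega)
  have hd1 : d ≤ 1 := pow_le_one₀ (by linarith) (by nlinarith)
  have hbdry : ∀ p ∈ frontier Ω, d ≤ (1 - (stdMatrix (fderivWithin ℝ u (closure Ω) p))ᵀ *
      stdMatrix (fderivWithin ℝ u (closure Ω) p)).det := fun p hp => by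
    refine pow_le_det (isHermitian_one_sub _) (by linarith) (quadratic_ge_of_norm_le fun v => ?_)
    refine (boundary_gradient_le hΩ_open hΩ_ne hΩ_bdd hΩ_conv hΩ_C2 hφ hu hκ0 hg hM0
      (fun x hx v => norm_second_fderiv_le hΩ_open hΩ_ne hΩ_bdd hΩ_conv hφ hx v) hb hp v).trans ?_
    have := supNorm_fderivWithin_le hΩ_open hΩ_ne hΩ_bdd hΩ_conv hφ hp
    gcongr
    linarith
  have hint : ∀ x ∈ Ω, d ≤ (inducedMetric u x).det := fun x hx => by
    -- The determinant is extended to the closure by `fderivWithin`, since `u` is controlled only on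
    -- `closure Ω` and `fderiv` need not be its boundary derivative.
    have hG : ∀ y ∈ Ω, (1 - (stdMatrix (fderivWithin ℝ u (closure Ω) y))ᵀ *
      stdMatrix (fderivWithin ℝ u (closure Ω) y)).det = (inducedMetric u y).det := fun y hy => by
      rw [fderivWithin_closure_eq hΩ_open hy, inducedMetric_eq_stdMatrix]
    rw [← hG x hx]
    exact le_det_of_le_on_frontier (by omega) hΩ_open hΩ_bdd hu.smooth hu.maximal hpos
      (continuousOn_det_stdMatrix hΩ_open hΩ_ne hΩ_conv hu.contDiffOn_closure) hG
      (hκ0.trans hκd) hbdry hx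
  -- Strictness survives the supremum because `d` does not depend on the point.
  refine lt_of_le_of_lt (b := 1 - d) (csSup_le (hΩ_ne.image _) ?_) (by linarith)
  rintro _ ⟨x, hx, rfl⟩
  exact supNorm_sq_le_one_sub_det (hpos x hx).posSemidef hd1 (hint x hx)

end Assembly

end MaximalGraph

theorem mainTheorem3 (m n : ℕ) (hm : 2 ≤ m) (hn : 1 ≤ n)
    (Ω : Set (MaximalGraph.E m)) (hΩ_open : IsOpen Ω) (hΩ_ne : Ω.Nonempty)
    (hΩ_bdd : Bornology.IsBounded Ω) (hΩ_conv : Convex ℝ Ω)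
    (hΩ_C2 : MaximalGraph.HasC2Boundary Ω)
    (φ : MaximalGraph.E m → MaximalGraph.E n) (hφ : ContDiffOn ℝ 2 φ (closure Ω))
    (κ : ℝ) (hκ0 : 0 < κ) (hκ1 : κ < 1)
    (hsmall :
      4 * (m : ℝ) * Metric.diam Ω / κ *
          sSup ((fun x => MaximalGraph.supNorm₂ (iteratedFDeriv ℝ 2 φ x)) '' Ω) +
        2 * sSup ((fun x => MaximalGraph.supNorm (fderivWithin ℝ φ (closure Ω) x)) ''
          frontier Ω) <
      Real.sqrt (1 - κ ^ (1 / (m : ℝ))))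
    (u : MaximalGraph.E m → MaximalGraph.E n)
    (hu : MaximalGraph.IsSmoothSolution Ω φ u)
    (hgrad : sSup ((fun x => MaximalGraph.supNorm (fderiv ℝ u x) ^ 2) '' Ω) ≤ 1 - κ) :
    sSup ((fun x => MaximalGraph.supNorm (fderiv ℝ u x) ^ 2) '' Ω) < 1 - κ :=
  MaximalGraph.sSup_supNorm_sq_lt m n hm Ω hΩ_open hΩ_ne hΩ_bdd hΩ_conv hΩ_C2 φ hφ κ hκ0 hκ1 hsmall u
    hu hgrad
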